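/- Let $a<b$ be real numbers, $d\ge 1$ an integer, and let $\alpha,p$ be real numbers with $0<\frac1p<\alpha<1$. Let $\|\cdot\|$ be the Euclidean norm on $\mathbb R^d$ and $L^p=L^p((a,b);\mathbb R^d)$. For $\beta>0$ let $$I^\beta_-f(t)=\frac1{\Gamma(\beta)}\int_a^t (t-\xi)^{\beta-1}f(\xi)\,d\xi$$ be the left Riemann–Liouville fractional integral, and let $D^\alpha_-f=\frac{d}{dt}\big(I^{1-\alpha}_-f\big)$ be the left Riemann–Liouville fractional derivative (where it exists). Put $$E_{\alpha,p}=\{u\in L^p:\ D^\alpha_-u \text{ exists a.e. on }(a,b),\ D^\alpha_-u\in L^p,\ I^\alpha_-(D^\alpha_-u)=u \text{ a.e. on }(a,b)\}.$$ Let $L:\mathbb R^d\times\mathbb R^d\times[a,b]\to\mathbb R$, $(x,y,t)\mapsto L(x,y,t)$, be of class $\mathscr C^1$, and assume the following, for all $(x,y,t)\in\mathbb R^d\times\mathbb R^d\times[a,b]$. - (H1) There are $0\le d_1\le p$ and continuous $r_1,s_1:\mathbb R^d\times[a,b]\to[0,\infty)$ with $|L(x,y,t)-L(x,0,t)|\le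 r_1(x,t)\|y\|^{d_1}+s_1(x,t)$. - (H2) There are $0\le d_2\le p$ and continuous $r_2,s_2:\mathbb R^d\times[a,b]\to[0,\infty)$ with $\big\|\frac{\partial L}{\partial x}(x,y,t)\big\|\le r_2(x,t)\|y\|^{d_2}+s_2(x,t)$. - (H3) There are $0\le d_3\le p-1$ and continuous $r_3,s_3:\mathbb R^d\times[a,b]\to[0,\infty)$ with $\big\|\frac{\partial L}{\partial y}(x,y,t)\big\|\le r_3(x,t)\|y\|^{d_3}+s_3(x,t)$. - (H4) There are $\gamma>0$, $1\le d_4<p$, a continuous $c_1:\mathbb R^d\times[a,b]\to[\gamma,\infty)$ and continuous $c_2,c_3:[a,b]\to\mathbb R$ with $L(x,y,t)\ge c_1(x,t)\|y\|^p+c_2(t)\|x\|^{d_4}+c_3(t)$. Assume moreover that at least one of the following holds. - (H5) For every $t\in[a,b]$, the function $L(\cdot,\cdot,t)$ is convex on $\mathbb R^d\times\mathbb R^d$. - (H5′) For every $(x,t)\in\mathbb R^d\times[a,b]$, $L(x,\cdot,t)$ is convex, and for every $\varepsilon>0$ there is $\delta>0$ such that $\|x_2-x_1\|<\delta$ implies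 $|L(x_2,y,t)-L(x_1,y,t)|<\varepsilon$ for all $(y,t)\in\mathbb R^d\times[a,b]$. - (H5″) For every $(x,t)\in\mathbb R^d\times[a,b]$, $L(x,\cdot,t)$ is convex. Then for every $u\in E_{\alpha,p}$ the function $t\mapsto L(u(t),D^\alpha_-u(t),t)$ is integrable on $(a,b)$, so that $$\mathcal L(u)=\int_a^b L\big(u(t),D^\alpha_-u(t),t\big)\,dt$$ is a well-defined real number, and $\mathcal L$ attains a global minimum on $E_{\alpha,p}$: there is $u\in E_{\alpha,p}$ with $\mathcal L(u)\le\mathcal L(v)$ for all $v\in E_{\alpha,p}$. -/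

import Mathlib

open MeasureTheory Set

noncomputable section

/-- The Euclidean space `ℝ^d`. -/
abbrev RR (d : ℕ) : Type := EuclideanSpace ℝ (Fin d)

/-- Lebesgue measure on the open interval `(a, b)`. -/
abbrev intervalMeasure (a b : ℝ) : Measure ℝ := volume.restrict (Ioo a b)

/-- Left Riemann-Liouville fractional integral of order `β > 0` with inferior limit `a`:
`I^β f (t) = (1 / Γ(β)) ∫_a^t (t - ξ)^(β - 1) f(ξ) dξ`. -/
def leftRLIntegral {d : ℕ} (a β : ℝ) (f : ℝ → RR d) (t : ℝ) : RR d :=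
  (1 / Real.Gamma β) • ∫ ξ in a..t, (t - ξ) ^ (β - 1) • f ξ

/-- Left Riemann-Liouville fractional derivative of order `0 < α < 1`:
`D^α f = d/dt (I^(1 - α) f)`. It is meaningful where `LeftRLDifferentiableAt` holds. -/
def leftRLDeriv {d : ℕ} (a α : ℝ) (f : ℝ → RR d) (t : ℝ) : RR d :=
  deriv (leftRLIntegral a (1 - α) f) t

/-- The left Riemann-Liouville derivative of order `α` of `f` exists at `t`. -/
def LeftRLDifferentiableAt {d : ℕ} (a α : ℝ) (f : ℝ → RR d) (t : ℝ) : Prop :=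
  DifferentiableAt ℝ (leftRLIntegral a (1 - α) f) t

/-- The Lebesgue space `L^p((a, b); ℝ^d)` for a real exponent `p`. -/
abbrev LpInterval (d : ℕ) (a b p : ℝ) : Type :=
  Lp (RR d) (ENNReal.ofReal p) (intervalMeasure a b)

/-- The space `E_{α,p}` of all `u ∈ L^p` whose fractional derivative `D^α u` is defined almost
everywhere and belongs to `L^p`, and which satisfy `I^α (D^α u) = u` (in `L^p`). -/
def fracSpace (d : ℕ) (a b α p : ℝ) : Set (LpInterval d a b p) :=
  {u | (∀ᵐ t ∂(intervalMeasure a b), LeftRLDifferentiableAt a α u t) ∧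
    MemLp (leftRLDeriv a α u) (ENNReal.ofReal p) (intervalMeasure a b) ∧
    leftRLIntegral a α (leftRLDeriv a α u) =ᵐ[intervalMeasure a b] u}

/-- The integrand `t ↦ L(u(t), D^α u(t), t)`. -/
def lagrangianIntegrand {d : ℕ} {a b p : ℝ} (α : ℝ) (L : RR d → RR d → ℝ → ℝ)
    (u : LpInterval d a b p) (t : ℝ) : ℝ :=
  L (u t) (leftRLDeriv a α u t) t

/-- The Lagrangian functional `𝓛(u) = ∫_a^b L(u, D^α u, t) dt`. -/
def lagrangianFunctional {d : ℕ} {a b p : ℝ} (α : ℝ) (L : RR d → RR d → ℝ → ℝ)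
    (u : LpInterval d a b p) : ℝ :=
  ∫ t in Ioo a b, lagrangianIntegrand α L u t

/-- `L` is of class `C¹` on `ℝ^d × ℝ^d × [a, b]`. -/
def LagrangianC1 {d : ℕ} (a b : ℝ) (L : RR d → RR d → ℝ → ℝ) : Prop :=
  ContDiffOn ℝ 1 (fun z : RR d × RR d × ℝ => L z.1 z.2.1 z.2.2)
    (univ ×ˢ (univ ×ˢ Icc a b))

/-- `r` is a continuous function from `ℝ^d × [a, b]` to `[m, ∞)`. -/
def ContinuousGE {d : ℕ} (a b m : ℝ) (r : RR d → ℝ → ℝ) : Prop :=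
  ContinuousOn (fun z : RR d × ℝ => r z.1 z.2) (univ ×ˢ Icc a b) ∧
    ∀ x : RR d, ∀ t ∈ Icc a b, m ≤ r x t

/-- Growth of `L` in its second variable. -/
def HypH1 {d : ℕ} (a b p : ℝ) (L : RR d → RR d → ℝ → ℝ) : Prop :=
  ∃ (d₁ : ℝ) (r₁ s₁ : RR d → ℝ → ℝ), 0 ≤ d₁ ∧ d₁ ≤ p ∧
    ContinuousGE a b 0 r₁ ∧ ContinuousGE a b 0 s₁ ∧
    ∀ x y : RR d, ∀ t ∈ Icc a b, |L x y t - L x 0 t| ≤ r₁ x t * ‖y‖ ^ d₁ + s₁ x t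

/-- Growth of `∂L/∂x`; the operator norm of the partial differential is the Euclidean norm of
the partial gradient. -/
def HypH2 {d : ℕ} (a b p : ℝ) (L : RR d → RR d → ℝ → ℝ) : Prop :=
  ∃ (d₂ : ℝ) (r₂ s₂ : RR d → ℝ → ℝ), 0 ≤ d₂ ∧ d₂ ≤ p ∧
    ContinuousGE a b 0 r₂ ∧ ContinuousGE a b 0 s₂ ∧
    ∀ x y : RR d, ∀ t ∈ Icc a b,
      ‖fderiv ℝ (fun x' => L x' y t) x‖ ≤ r₂ x t * ‖y‖ ^ d₂ + s₂ x t

/-- Growth of `∂L/∂y`. -/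
def HypH3 {d : ℕ} (a b p : ℝ) (L : RR d → RR d → ℝ → ℝ) : Prop :=
  ∃ (d₃ : ℝ) (r₃ s₃ : RR d → ℝ → ℝ), 0 ≤ d₃ ∧ d₃ ≤ p - 1 ∧
    ContinuousGE a b 0 r₃ ∧ ContinuousGE a b 0 s₃ ∧
    ∀ x y : RR d, ∀ t ∈ Icc a b,
      ‖fderiv ℝ (fun y' => L x y' t) y‖ ≤ r₃ x t * ‖y‖ ^ d₃ + s₃ x t

/-- Coercivity condition. -/
def HypH4 {d : ℕ} (a b p : ℝ) (L : RR d → RR d → ℝ → ℝ) : Prop :=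
  ∃ (γ d₄ : ℝ) (c₁ : RR d → ℝ → ℝ) (c₂ c₃ : ℝ → ℝ), 0 < γ ∧ 1 ≤ d₄ ∧ d₄ < p ∧
    ContinuousGE a b γ c₁ ∧ ContinuousOn c₂ (Icc a b) ∧ ContinuousOn c₃ (Icc a b) ∧
    ∀ x y : RR d, ∀ t ∈ Icc a b, c₁ x t * ‖y‖ ^ p + c₂ t * ‖x‖ ^ d₄ + c₃ t ≤ L x y t

/-- Joint convexity: `L(·, ·, t)` is convex for every `t ∈ [a, b]`. -/
def HypH5 {d : ℕ} (a b : ℝ) (L : RR d → RR d → ℝ → ℝ) : Prop :=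
  ∀ t ∈ Icc a b, ConvexOn ℝ univ (fun z : RR d × RR d => L z.1 z.2 t)

/-- Partial convexity: `L(x, ·, t)` is convex for every `(x, t)`. -/
def HypH5'' {d : ℕ} (a b : ℝ) (L : RR d → RR d → ℝ → ℝ) : Prop :=
  ∀ x : RR d, ∀ t ∈ Icc a b, ConvexOn ℝ univ (fun y => L x y t)

/-- Partial convexity together with uniform equicontinuity on `ℝ^d` of the family
`L(·, y, t)`, `(y, t) ∈ ℝ^d × [a, b]`. -/
def HypH5' {d : ℕ} (a b : ℝ) (L : RR d → RR d → ℝ → ℝ) : Prop :=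
  (∀ x : RR d, ∀ t ∈ Icc a b, ConvexOn ℝ univ (fun y => L x y t)) ∧
    ∀ ε > 0, ∃ δ > 0, ∀ x₁ x₂ : RR d, ‖x₂ - x₁‖ < δ →
      ∀ y : RR d, ∀ t ∈ Icc a b, |L x₂ y t - L x₁ y t| < ε

end

/-! Write `u = I^α v` with `v = D^α u`. On `E_{α,p}` this holds by definition. Conversely every `v ∈
L^p` arises, since `I^(1-α) I^α v = I^1 v` (Fubini and the Beta integral) and Lebesgue
differentiation gives `D^α I^α v = v` a.e. So the task is to minimize `J(v) = ∫ L(I^α v, v, t)` over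
all of `L^p`.

Since `α > 1/p`, Hölder's inequality bounds the increments of `I^α v` by a modulus of continuity
times `‖v‖_p`. With (H4) this makes `J` coercive, because the negative term grows like `‖v‖_p^d₄`
with `d₄ < p`. A minimizing sequence `V n` is therefore bounded in `L^p`, and by Arzelà–Ascoli a
subsequence of `I^α (V n)` converges uniformly to some `u`. By (H2), replacing `I^α (V n)` by `u`
inside `L` costs a vanishing amount.

With `u` frozen, only convexity in `y` is needed, and each of (H5), (H5′), (H5″) provides it. The
almost minimizers of `w ↦ ∫ L(u, w, t)` that are bounded in `L^p` and have `I^α w` close to `u` form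
decreasing convex sets. Weak compactness is replaced by `exists_tendsto_ae_of_antitone_convex`, a
Komlós-type selection: nearly minimizing a strictly convex functional on each set gives a sequence
that is Cauchy in measure, hence a.e. convergent along a subsequence, to some `v`. Convergence of
`L^p`–`L^q` pairings shows `I^α v = u`, and Fatou's lemma gives `J(v) ≤ inf J`. -/

open Filter Topology

/-! ### Strict convexity of the area function -/

/-- The area function `y ↦ √(1 + ‖y‖²)`, a strictly convex function of linear growth. -/
noncomputable def areaFun {E : Type*} [NormedAddCommGroup E] (y : E) : ℝ :=
  ‖(WithLp.toLp 2 ((1 : ℝ), y) : WithLp 2 (ℝ × E))‖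

section areaFun
variable {E : Type*} [NormedAddCommGroup E]

lemma areaFun_eq_sqrt (y : E) : areaFun y = √(1 + ‖y‖ ^ 2) := by
  simp [areaFun, WithLp.prod_norm_eq_of_L2]

lemma continuous_areaFun : Continuous (areaFun : E → ℝ) := by
  simp_rw [funext areaFun_eq_sqrt]
  fun_prop

lemma areaFun_nonneg (y : E) : 0 ≤ areaFun y := norm_nonneg _

lemma areaFun_le (y : E) : areaFun y ≤ 1 + ‖y‖ := by
  rw [areaFun_eq_sqrt]
  refine Real.sqrt_le_iff.2 ⟨by positivity, ?_⟩
  nlinarith [norm_nonneg y]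

variable [InnerProductSpace ℝ E]

/-- The area function is the Euclidean norm of `(1, y)`. Vectors `(1, y)` and `(1, z)` on a common
ray must coincide, so the strict triangle inequality applies whenever `y ≠ z`. -/
lemma areaFun_midpoint_lt {y z : E} (h : y ≠ z) :
    0 < (areaFun y + areaFun z) / 2 - areaFun ((1 / 2 : ℝ) • (y + z)) := by
  have key : ¬ SameRay ℝ (WithLp.toLp 2 ((1 : ℝ), y) : WithLp 2 (ℝ × E))
      (WithLp.toLp 2 ((1 : ℝ), z)) := by
    intro hs
    rcases hs with h0 | h0 | ⟨r₁, r₂, h1, h2, h3⟩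
    · simpa using congrArg (fun w : WithLp 2 (ℝ × E) => w.fst) h0
    · simpa using congrArg (fun w : WithLp 2 (ℝ × E) => w.fst) h0
    · have e1 : r₁ = r₂ := by
        simpa using congrArg (fun w : WithLp 2 (ℝ × E) => w.fst) h3
      have e2 : r₁ • y = r₂ • z := by
        simpa using congrArg (fun w : WithLp 2 (ℝ × E) => w.snd) h3
      subst e1
      exact h (smul_right_injective E h1.ne' e2)
  have h1 := norm_add_lt_of_not_sameRay key
  have h2 : (WithLp.toLp 2 ((1 : ℝ), (1 / 2 : ℝ) • (y + z)) : WithLp 2 (ℝ × E)) =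
      (1 / 2 : ℝ) • (WithLp.toLp 2 ((1 : ℝ), y) + WithLp.toLp 2 ((1 : ℝ), z)) := by
    rw [← WithLp.toLp_add, ← WithLp.toLp_smul]
    congr 1
    ext
    · simp; norm_num
    · simp
  unfold areaFun
  rw [h2, norm_smul]
  norm_num at h1 ⊢
  linarith

lemma areaFun_midpoint_le (y z : E) :
    0 ≤ (areaFun y + areaFun z) / 2 - areaFun ((1 / 2 : ℝ) • (y + z)) := by
  rcases eq_or_ne y z with rfl | h
  · have : (1 / 2 : ℝ) • (y + y) = y := by rw [← two_smul ℝ y, smul_smul]; norm_num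
    rw [this]; linarith
  · exact (areaFun_midpoint_lt h).le

/-- Quantitative strict convexity of the area function on bounded sets. -/
lemma exists_areaFun_gap [FiniteDimensional ℝ E] (R : ℝ) {ε : ℝ} (hε : 0 < ε) :
    ∃ η > 0, ∀ y z : E, ‖y‖ ≤ R → ‖z‖ ≤ R → ε ≤ ‖y - z‖ →
      η ≤ (areaFun y + areaFun z) / 2 - areaFun ((1 / 2 : ℝ) • (y + z)) := by
  -- The gap is continuous and positive on this compact set, so its minimum there serves as `η`. If
  -- the set is empty, any positive constant will do.
  let S : Set (E × E) := (Metric.closedBall 0 R ×ˢ Metric.closedBall 0 R) ∩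
    {w | ε ≤ ‖w.1 - w.2‖}
  have hS : IsCompact S := by
    have := FiniteDimensional.proper_real E
    exact ((isCompact_closedBall _ _).prod (isCompact_closedBall _ _)).inter_right
      (isClosed_le continuous_const (by fun_prop))
  have hc : Continuous fun w : E × E =>
      (areaFun w.1 + areaFun w.2) / 2 - areaFun ((1 / 2 : ℝ) • (w.1 + w.2)) := by
    have := continuous_areaFun (E := E)
    fun_prop
  rcases S.eq_empty_or_nonempty with he | hne
  · refine ⟨1, one_pos, fun y z hy hz hyz => ?_⟩
    have : (y, z) ∈ S := ⟨⟨by simpa using hy, by simpa using hz⟩, hyz⟩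
    simp [he] at this
  · obtain ⟨w, hw, hmin⟩ := hS.exists_isMinOn hne hc.continuousOn
    refine ⟨_, areaFun_midpoint_lt (y := w.1) (z := w.2) ?_, fun y z hy hz hyz => ?_⟩
    · intro h
      have := hw.2
      simp [h] at this
      linarith
    · have hmem : (y, z) ∈ S := ⟨⟨by simpa using hy, by simpa using hz⟩, hyz⟩
      exact isMinOn_iff.1 hmin (y, z) hmem

end areaFun

/-! ### Almost everywhere convergent selections from convex sets -/

section Komlos
variable {Ω E : Type*} [MeasurableSpace Ω] {μ : Measure Ω} [NormedAddCommGroup E]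

/-- A sequence which is Cauchy in measure has a subsequence converging almost everywhere. -/
lemma exists_subseq_tendsto_ae_of_cauchy_in_measure [CompleteSpace E] {w : ℕ → Ω → E}
    (hw : ∀ ε > 0, ∀ δ > 0, ∃ N, ∀ i ≥ N, ∀ j ≥ i,
      μ {x | ε ≤ ‖w i x - w j x‖} ≤ ENNReal.ofReal δ) :
    ∃ φ : ℕ → ℕ, StrictMono φ ∧ ∃ v : Ω → E,
      ∀ᵐ x ∂μ, Tendsto (fun k => w (φ k) x) atTop (𝓝 (v x)) := by
  choose N hN using fun k : ℕ => hw ((1 / 2 : ℝ) ^ k) (by positivity) ((1 / 2 : ℝ) ^ k)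
    (by positivity)
  obtain ⟨φ, hφ, hφN⟩ : ∃ φ : ℕ → ℕ, StrictMono φ ∧ ∀ k, N k ≤ φ k := by
    refine Filter.extraction_forall_of_eventually' (P := fun n m => N n ≤ m) fun n => ⟨N n, fun m hm => hm⟩
  refine ⟨φ, hφ, ?_⟩
  -- Summability feeds Borel–Cantelli: almost every point eventually has consecutive distances below
  -- `2^(-k)`.
  have hsum : ∑' k, μ {x | (1 / 2 : ℝ) ^ k ≤ ‖w (φ k) x - w (φ (k + 1)) x‖} ≠ ⊤ := by
    have h1 : ∑' k : ℕ, ENNReal.ofReal ((1 / 2 : ℝ) ^ k) ≠ ⊤ := by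
      rw [← ENNReal.ofReal_tsum_of_nonneg (fun k => by positivity)
        (summable_geometric_of_lt_one (by norm_num) (by norm_num))]
      exact ENNReal.ofReal_ne_top
    refine ne_top_of_le_ne_top h1 (ENNReal.tsum_le_tsum fun k => ?_)
    exact hN k _ (hφN k) _ (hφ (Nat.lt_succ_self k)).le
  have hcau : ∀ᵐ x ∂μ, ∃ l, Tendsto (fun k => w (φ k) x) atTop (𝓝 l) := by
    filter_upwards [ae_eventually_notMem hsum] with x hx
    apply cauchySeq_tendsto_of_complete
    obtain ⟨n, hn⟩ := eventually_atTop.1 hx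
    rw [← cauchySeq_shift n]
    refine cauchySeq_of_le_geometric (1 / 2) ((1 / 2) ^ n) (by norm_num) fun k => ?_
    have := hn (k + n) (by omega)
    rw [not_le] at this
    rw [dist_eq_norm, ← pow_add, add_comm n k, show k + 1 + n = k + n + 1 by ring]
    exact this.le
  choose! v hv using fun x (h : ∃ l, Tendsto (fun k => w (φ k) x) atTop (𝓝 l)) => h
  exact ⟨v, hcau.mono fun x hx => hv x hx⟩

variable [InnerProductSpace ℝ E] [FiniteDimensional ℝ E]

/-- A decreasing sequence of nonempty convex sets of functions, bounded in `L¹`, admits a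
selection which converges almost everywhere. -/
theorem exists_tendsto_ae_of_antitone_convex [IsFiniteMeasure μ] {K : ℕ → Set (Ω → E)}
    (hconv : ∀ k, Convex ℝ (K k)) (hanti : Antitone K) (hne : ∀ k, (K k).Nonempty)
    (hint : ∀ w ∈ K 0, Integrable w μ) {M : ℝ} (hM : ∀ w ∈ K 0, ∫ x, ‖w x‖ ∂μ ≤ M) :
    ∃ (w : ℕ → Ω → E) (v : Ω → E), (∀ k, w k ∈ K k) ∧
      ∀ᵐ x ∂μ, Tendsto (fun k => w k x) atTop (𝓝 (v x)) := by
  have hint' : ∀ k, ∀ w ∈ K k, Integrable w μ := fun k w hw => hint w (hanti (Nat.zero_le k) hw)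
  have hM' : ∀ k, ∀ w ∈ K k, ∫ x, ‖w x‖ ∂μ ≤ M := fun k w hw => hM w (hanti (Nat.zero_le k) hw)
  have harea : ∀ w : Ω → E, Integrable w μ → Integrable (fun x => areaFun (w x)) μ := by
    intro w hw
    refine Integrable.mono' ((integrable_const (1 : ℝ)).add hw.norm)
      (continuous_areaFun.comp_aestronglyMeasurable hw.1) (Eventually.of_forall fun x => ?_)
    rw [Real.norm_of_nonneg (areaFun_nonneg _)]
    exact areaFun_le _
  let Φ : (Ω → E) → ℝ := fun w => ∫ x, areaFun (w x) ∂μ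
  let C : ℝ := μ.real univ + M
  have hΦC : ∀ k, ∀ w ∈ K k, Φ w ≤ C := by
    intro k w hw
    calc Φ w ≤ ∫ x, (1 + ‖w x‖) ∂μ := integral_mono (harea w (hint' k w hw))
          ((integrable_const (1 : ℝ)).add (hint' k w hw).norm) fun x => areaFun_le _
      _ = μ.real univ + ∫ x, ‖w x‖ ∂μ := by
          rw [integral_add (integrable_const _) (hint' k w hw).norm]; simp
      _ ≤ C := by simp only [C]; linarith [hM' k w hw]
  have hΦ0 : ∀ w, 0 ≤ Φ w := fun w => integral_nonneg fun x => areaFun_nonneg _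
  have hbdd : ∀ k, BddBelow (Φ '' K k) := fun k => ⟨0, by rintro _ ⟨w, -, rfl⟩; exact hΦ0 w⟩
  -- The infima increase with `k` and are bounded, hence converge. This is what forces
  -- near-minimizers from different sets to be close.
  let m : ℕ → ℝ := fun k => sInf (Φ '' K k)
  have hm_le : ∀ k, ∀ w ∈ K k, m k ≤ Φ w := fun k w hw =>
    csInf_le (hbdd k) (mem_image_of_mem _ hw)
  have hm_mono : Monotone m := fun i j hij =>
    csInf_le_csInf (hbdd i) ((hne j).image _) (image_mono (hanti hij))
  have hm_bdd : BddAbove (range m) := by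
    refine ⟨C, ?_⟩
    rintro _ ⟨k, rfl⟩
    obtain ⟨w, hw⟩ := hne k
    exact (hm_le k w hw).trans (hΦC k w hw)
  let m₀ : ℝ := ⨆ k, m k
  have hm_lim : Tendsto m atTop (𝓝 m₀) := tendsto_atTop_ciSup hm_mono hm_bdd
  have hm₀ : ∀ k, m k ≤ m₀ := le_ciSup hm_bdd
  have hex : ∀ k : ℕ, ∃ w ∈ K k, Φ w < m k + 1 / ((k : ℝ) + 1) := by
    intro k
    obtain ⟨_, ⟨w, hw, rfl⟩, h⟩ := exists_lt_of_csInf_lt ((hne k).image Φ)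
      (show sInf (Φ '' K k) < m k + 1 / ((k : ℝ) + 1) by
        have : (0 : ℝ) < 1 / ((k : ℝ) + 1) := by positivity
        change m k < _
        linarith)
    exact ⟨w, hw, h⟩
  choose w hwK hwΦ using hex
  let gap : ℕ → ℕ → Ω → ℝ := fun i j x =>
    (areaFun (w i x) + areaFun (w j x)) / 2 - areaFun ((1 / 2 : ℝ) • (w i x + w j x))
  have hmid : ∀ i j, i ≤ j → (fun x => (1 / 2 : ℝ) • (w i x + w j x)) ∈ K i := by
    intro i j hij
    have := hconv i (hwK i) (hanti hij (hwK j)) (a := 1 / 2) (b := 1 / 2) (by norm_num)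
      (by norm_num) (by norm_num)
    convert this using 1
    ext x
    simp
  have hwint : ∀ i, Integrable (w i) μ := fun i => hint' i _ (hwK i)
  have hgap_int : ∀ i j, i ≤ j → Integrable (gap i j) μ := fun i j hij =>
    (((harea _ (hwint i)).add (harea _ (hwint j))).div_const 2).sub
      (harea _ (hint' i _ (hmid i j hij)))
  -- The midpoint of `w i` and `w j` lies in `K i`, so its energy is at least `m i`, while the
  -- energies of `w i` and `w j` exceed `m i` and `m j ≤ m₀` by at most `1 / (i + 1)`.
  have hgap : ∀ i j, i ≤ j → ∫ x, gap i j x ∂μ ≤ (m₀ - m i) / 2 + 1 / ((i : ℝ) + 1) := by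
    intro i j hij
    have e1 : ∫ x, gap i j x ∂μ = (Φ (w i) + Φ (w j)) / 2 -
        Φ (fun x => (1 / 2 : ℝ) • (w i x + w j x)) := by
      simp only [gap, Φ]
      have hs : Integrable (fun x => (areaFun (w i x) + areaFun (w j x)) / 2) μ :=
        ((harea _ (hwint i)).add (harea _ (hwint j))).div_const 2
      rw [integral_sub hs (harea _ (hint' i _ (hmid i j hij))), integral_div,
        integral_add (harea _ (hwint i)) (harea _ (hwint j))]
    have h1 := hwΦ i
    have h2 := hwΦ j
    have h3 := hm_le i _ (hmid i j hij)
    have h4 := hm₀ j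
    have h5 : 1 / ((j : ℝ) + 1) ≤ 1 / ((i : ℝ) + 1) := by
      have : (i : ℝ) ≤ j := by exact_mod_cast hij
      gcongr
    rw [e1]
    linarith
  have hgap_lim : Tendsto (fun i : ℕ => (m₀ - m i) / 2 + 1 / ((i : ℝ) + 1)) atTop (𝓝 0) := by
    have := ((tendsto_const_nhds (x := m₀)).sub hm_lim).div_const 2
    simpa using this.add tendsto_one_div_add_atTop_nhds_zero_nat
  have hM0 : 0 ≤ M := by
    obtain ⟨w, hw⟩ := hne 0
    exact (integral_nonneg fun x => norm_nonneg _).trans (hM w hw)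
  have hcau : ∀ ε > 0, ∀ δ > 0, ∃ N, ∀ i ≥ N, ∀ j ≥ i,
      μ {x | ε ≤ ‖w i x - w j x‖} ≤ ENNReal.ofReal δ := by
    intro ε hε δ hδ
    -- By Markov's inequality this threshold leaves mass at most `δ / 4` where `‖w i‖ ≥ R`. Two such
    -- sets and the set of large gap add up to less than `δ`.
    let R : ℝ := (M + 1) / (δ / 4)
    have hR : 0 < R := by positivity
    have hlarge : ∀ i, μ.real {x | R ≤ ‖w i x‖} ≤ δ / 4 := by
      intro i
      have h1 := mul_meas_ge_le_integral_of_nonneg (μ := μ) (f := fun x => ‖w i x‖)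
        (Eventually.of_forall fun x => norm_nonneg _) (hwint i).norm R
      have h2 := hM' i _ (hwK i)
      have h3 : R * μ.real {x | R ≤ ‖w i x‖} ≤ R * (δ / 4) := by
        have : R * (δ / 4) = M + 1 := by simp only [R]; field_simp
        rw [this]
        linarith
      exact le_of_mul_le_mul_left h3 hR
    obtain ⟨η, hη, hgapη⟩ := exists_areaFun_gap (E := E) R hε
    obtain ⟨N, hN⟩ := eventually_atTop.1
      (hgap_lim.eventually (gt_mem_nhds (show (0 : ℝ) < η * (δ / 4) by positivity)))
    refine ⟨N, fun i hi j hij => ?_⟩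
    have hsmall : μ.real {x | η ≤ gap i j x} ≤ δ / 4 := by
      have h1 := mul_meas_ge_le_integral_of_nonneg (μ := μ) (f := gap i j)
        (Eventually.of_forall fun x => areaFun_midpoint_le _ _) (hgap_int i j hij) η
      have h2 := hgap i j hij
      have h3 := hN i hi
      exact le_of_mul_le_mul_left (by linarith) hη
    have hsub : {x | ε ≤ ‖w i x - w j x‖} ⊆
        ({x | R ≤ ‖w i x‖} ∪ {x | R ≤ ‖w j x‖}) ∪ {x | η ≤ gap i j x} := by
      intro x hx
      by_contra hcon
      simp only [mem_union, mem_ofPred_eq, not_or, not_le] at hcon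
      exact absurd (hgapη _ _ hcon.1.1.le hcon.1.2.le hx) (not_le.2 hcon.2)
    have htot : μ.real {x | ε ≤ ‖w i x - w j x‖} ≤ δ := by
      have h1 := measureReal_mono (μ := μ) hsub
      have h2 := measureReal_union_le (μ := μ) ({x | R ≤ ‖w i x‖} ∪ {x | R ≤ ‖w j x‖})
        {x | η ≤ gap i j x}
      have h3 := measureReal_union_le (μ := μ) {x | R ≤ ‖w i x‖} {x | R ≤ ‖w j x‖}
      linarith [hlarge i, hlarge j]
    rw [← ENNReal.ofReal_toReal (measure_ne_top μ _)]
    exact ENNReal.ofReal_le_ofReal htot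
  have := FiniteDimensional.complete ℝ E
  obtain ⟨φ, hφ, v, hv⟩ := exists_subseq_tendsto_ae_of_cauchy_in_measure hcau
  -- Since `k ≤ φ k` and the sets decrease, passing to the subsequence keeps the `k`-th term in `K
  -- k`.
  exact ⟨fun k => w (φ k), v, fun k => hanti (hφ.id_le k) (hwK _), hv⟩

end Komlos

/-! ### Fatou's lemma and convergence of pairings -/

section Integration
variable {Ω E : Type*} [MeasurableSpace Ω] {μ : Measure Ω} [NormedAddCommGroup E]

lemma memLp_ofReal_iff_integrable_rpow {p : ℝ} (hp : 0 < p) {f : Ω → E}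
    (hf : AEStronglyMeasurable f μ) :
    MemLp f (ENNReal.ofReal p) μ ↔ Integrable (fun x => ‖f x‖ ^ p) μ := by
  rw [← integrable_norm_rpow_iff hf (by simpa using hp) (by simp), ENNReal.toReal_ofReal hp.le]

/-- Fatou's lemma for real functions bounded below by an integrable function. -/
lemma integrable_and_integral_le_of_tendsto_ae {f : ℕ → Ω → ℝ} {g G : Ω → ℝ} {c : ℕ → ℝ} {C : ℝ}
    (hf : ∀ k, Integrable (f k) μ) (hG : Integrable G μ) (hGf : ∀ k, G ≤ᵐ[μ] f k)
    (hlim : ∀ᵐ x ∂μ, Tendsto (fun k => f k x) atTop (𝓝 (g x)))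
    (hfc : ∀ k, ∫ x, f k x ∂μ ≤ c k) (hc : Tendsto c atTop (𝓝 C)) :
    Integrable g μ ∧ ∫ x, g x ∂μ ≤ C := by
  have hgm : AEStronglyMeasurable g μ := aestronglyMeasurable_of_tendsto_ae atTop
    (fun k => (hf k).1) hlim
  have hGg : G ≤ᵐ[μ] g := by
    filter_upwards [hlim, ae_all_iff.2 hGf] with x hx hG
    exact ge_of_tendsto' hx hG
  have h1 : ∫⁻ x, ENNReal.ofReal (g x - G x) ∂μ ≤
      liminf (fun k => ∫⁻ x, ENNReal.ofReal (f k x - G x) ∂μ) atTop := by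
    calc ∫⁻ x, ENNReal.ofReal (g x - G x) ∂μ
        = ∫⁻ x, liminf (fun k => ENNReal.ofReal (f k x - G x)) atTop ∂μ := by
          refine lintegral_congr_ae ?_
          filter_upwards [hlim] with x hx
          exact (((ENNReal.continuous_ofReal.tendsto _).comp
            (hx.sub_const (G x))).liminf_eq).symm
      _ ≤ _ := lintegral_liminf_le' fun k => ((hf k).sub hG).1.aemeasurable.ennreal_ofReal
  have h2 : ∀ k, ∫⁻ x, ENNReal.ofReal (f k x - G x) ∂μ ≤
      ENNReal.ofReal (c k - ∫ x, G x ∂μ) := by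
    intro k
    have hk : Integrable (fun x => f k x - G x) μ := (hf k).sub hG
    rw [← ofReal_integral_eq_lintegral_ofReal hk
      ((hGf k).mono fun x hx => sub_nonneg.2 hx)]
    refine ENNReal.ofReal_le_ofReal ?_
    rw [integral_sub (hf k) hG]
    linarith [hfc k]
  have h3 : ∫⁻ x, ENNReal.ofReal (g x - G x) ∂μ ≤ ENNReal.ofReal (C - ∫ x, G x ∂μ) := by
    refine h1.trans ((liminf_le_liminf (Eventually.of_forall h2)).trans (le_of_eq ?_))
    exact ((ENNReal.continuous_ofReal.tendsto _).comp (hc.sub_const _)).liminf_eq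
  have hGg' : 0 ≤ᵐ[μ] fun x => g x - G x := hGg.mono fun x hx => sub_nonneg.2 hx
  have hint : Integrable (fun x => g x - G x) μ :=
    (lintegral_ofReal_ne_top_iff_integrable (hgm.sub hG.1) hGg').1
      (ne_top_of_le_ne_top ENNReal.ofReal_ne_top h3)
  have hg : Integrable g μ := (hint.add hG).congr (Eventually.of_forall fun x => by simp)
  refine ⟨hg, ?_⟩
  have hC : 0 ≤ C - ∫ x, G x ∂μ := by
    refine ge_of_tendsto' (hc.sub_const _) fun k => ?_
    have := integral_mono_ae hG (hf k) (hGf k)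
    linarith [hfc k]
  rw [← ofReal_integral_eq_lintegral_ofReal hint hGg', ENNReal.ofReal_le_ofReal_iff hC,
    integral_sub hg hG] at h3
  linarith

/-- Almost everywhere convergence together with a bound in `L^p`, `p > 1`, yields convergence of
the pairings with a function of the conjugate Lebesgue space. -/
lemma tendsto_integral_smul_of_tendsto_ae [NormedSpace ℝ E] {p q : ℝ} (hpq : p.HolderConjugate q)
    {g : Ω → ℝ} (hg : MemLp g (ENNReal.ofReal q) μ) {w : ℕ → Ω → E} {v : Ω → E} {M : ℝ}
    (hw : ∀ k, MemLp (w k) (ENNReal.ofReal p) μ) (hv : MemLp v (ENNReal.ofReal p) μ)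
    (hM : ∀ k, ∫ x, ‖w k x - v x‖ ^ p ∂μ ≤ M)
    (hlim : ∀ᵐ x ∂μ, Tendsto (fun k => w k x) atTop (𝓝 (v x))) :
    Tendsto (fun k => ∫ x, g x • w k x ∂μ) atTop (𝓝 (∫ x, g x • v x ∂μ)) := by
  have : ENNReal.HolderTriple (ENNReal.ofReal q) (ENNReal.ofReal p) 1 :=
    hpq.symm.ennrealOfReal
  have hgw : ∀ k, Integrable (fun x => g x • w k x) μ := fun k =>
    memLp_one_iff_integrable.1 ((hw k).smul hg)
  have hgv : Integrable (fun x => g x • v x) μ := memLp_one_iff_integrable.1 (hv.smul hg)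
  have hgz : ∀ k, Integrable (fun x => ‖g x‖ * ‖w k x - v x‖) μ := fun k => by
    simpa [norm_smul, ← smul_sub] using ((hgw k).sub hgv).norm
  have hzp : ∀ k, Integrable (fun x => ‖w k x - v x‖ ^ p) μ := fun k =>
    (memLp_ofReal_iff_integrable_rpow hpq.pos ((hw k).sub hv).1).1 ((hw k).sub hv)
  have hgq := (memLp_ofReal_iff_integrable_rpow hpq.symm.pos hg.1).1 hg
  have hM0 : 0 ≤ M := (integral_nonneg fun x => by positivity).trans (hM 0)
  have key : Tendsto (fun k => ∫ x, ‖g x‖ * ‖w k x - v x‖ ∂μ) atTop (𝓝 0) := by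
    rw [Metric.tendsto_atTop]
    intro ε hε
    obtain ⟨δ, hδ, hδε⟩ : ∃ δ > 0, δ ^ p / p * M < ε / 2 := by
      have hc : Tendsto (fun δ : ℝ => δ ^ p / p * M) (𝓝[>] 0) (𝓝 0) := by
        have : ContinuousAt (fun δ : ℝ => δ ^ p / p * M) 0 := by
          have := Real.continuousAt_rpow_const 0 p (Or.inr hpq.nonneg)
          fun_prop
        have := this.tendsto.mono_left (nhdsWithin_le_nhds (s := Ioi 0))
        simpa [Real.zero_rpow hpq.ne_zero] using this
      obtain ⟨δ, h1, h2⟩ := ((hc.eventually (gt_mem_nhds (half_pos hε))).and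
        self_mem_nhdsWithin).exists
      exact ⟨δ, h2, h1⟩
    -- By Young's inequality applied to `δ ‖w - v‖` and `‖g‖ / δ`, this excess is dominated by a
    -- multiple of `‖g‖ ^ q` independent of `k`, so dominated convergence applies. The subtracted
    -- part integrates to less than `ε / 2` by the choice of `δ`.
    let h : ℕ → Ω → ℝ := fun k x => max (‖g x‖ * ‖w k x - v x‖ - δ ^ p / p * ‖w k x - v x‖ ^ p) 0
    have hh : Tendsto (fun k => ∫ x, h k x ∂μ) atTop (𝓝 0) := by
      have := tendsto_integral_of_dominated_convergence (μ := μ) (F := h) (f := fun _ => (0 : ℝ))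
        (bound := fun x => (1 / δ) ^ q / q * ‖g x‖ ^ q)
        (fun k => (((hgz k).sub ((hzp k).const_mul _)).sup (integrable_zero _ _ _)).1)
        (hgq.const_mul _) ?_ ?_
      · simpa using this
      · intro k
        refine Eventually.of_forall fun x => ?_
        rw [Real.norm_of_nonneg (le_max_right _ _)]
        refine max_le ?_ (by have := hpq.symm.pos; positivity)
        have := Real.young_inequality_of_nonneg (a := δ * ‖w k x - v x‖) (b := 1 / δ * ‖g x‖)
          (by positivity) (by positivity) hpq
        rw [Real.mul_rpow hδ.le (norm_nonneg _), Real.mul_rpow (by positivity) (norm_nonneg _),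
          show δ * ‖w k x - v x‖ * (1 / δ * ‖g x‖) = ‖g x‖ * ‖w k x - v x‖ by
            field_simp] at this
        have e1 : δ ^ p * ‖w k x - v x‖ ^ p / p = δ ^ p / p * ‖w k x - v x‖ ^ p := by ring
        have e2 : (1 / δ) ^ q * ‖g x‖ ^ q / q = (1 / δ) ^ q / q * ‖g x‖ ^ q := by ring
        linarith
      · filter_upwards [hlim] with x hx
        have h0 : Tendsto (fun k => ‖w k x - v x‖) atTop (𝓝 0) :=
          tendsto_iff_norm_sub_tendsto_zero.1 hx
        have hcont : ContinuousAt
            (fun s : ℝ => max (‖g x‖ * s - δ ^ p / p * s ^ p) 0) 0 := by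
          have := Real.continuousAt_rpow_const 0 p (Or.inr hpq.nonneg)
          fun_prop
        have := hcont.tendsto.comp h0
        simpa [Real.zero_rpow hpq.ne_zero, Function.comp_def, h] using this
    obtain ⟨N, hN⟩ := eventually_atTop.1 (hh.eventually (gt_mem_nhds (half_pos hε)))
    refine ⟨N, fun k hk => ?_⟩
    have hhk : Integrable (h k) μ :=
      ((hgz k).sub ((hzp k).const_mul _)).sup (integrable_zero _ _ _)
    have hle : ∫ x, ‖g x‖ * ‖w k x - v x‖ ∂μ ≤
        ∫ x, h k x ∂μ + δ ^ p / p * ∫ x, ‖w k x - v x‖ ^ p ∂μ := by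
      rw [← integral_const_mul, ← integral_add hhk ((hzp k).const_mul _)]
      refine integral_mono (hgz k) (hhk.add ((hzp k).const_mul _)) fun x => ?_
      have := le_max_left (‖g x‖ * ‖w k x - v x‖ - δ ^ p / p * ‖w k x - v x‖ ^ p) 0
      simp only [h]
      linarith
    have hδp : 0 ≤ δ ^ p / p := by have := hpq.pos; positivity
    have h2 := mul_le_mul_of_nonneg_left (hM k) hδp
    rw [Real.dist_eq, sub_zero, abs_of_nonneg (integral_nonneg fun x => by positivity)]
    linarith [hN k hk]
  rw [tendsto_iff_norm_sub_tendsto_zero]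
  refine squeeze_zero (fun _ => norm_nonneg _) (fun k => ?_) key
  rw [← integral_sub (hgw k) hgv]
  refine (norm_integral_le_integral_norm _).trans (le_of_eq ?_)
  simp [norm_smul, ← smul_sub]

end Integration

/-! ### The Riemann–Liouville kernel -/

/-- The truncated power `(t - ξ)_+^(β - 1)`, the kernel of the left Riemann-Liouville integral. -/
noncomputable def rlKernel (β t ξ : ℝ) : ℝ := (Iio t).indicator (fun ξ => (t - ξ) ^ (β - 1)) ξ

lemma rlKernel_of_lt {β t ξ : ℝ} (h : ξ < t) : rlKernel β t ξ = (t - ξ) ^ (β - 1) :=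
  indicator_of_mem (s := Iio t) h _

lemma rlKernel_of_le {β t ξ : ℝ} (h : t ≤ ξ) : rlKernel β t ξ = 0 :=
  indicator_of_notMem (s := Iio t) (not_lt.2 h) _

lemma rlKernel_nonneg (β t ξ : ℝ) : 0 ≤ rlKernel β t ξ := by
  rcases lt_or_ge ξ t with h | h
  · rw [rlKernel_of_lt h]
    exact Real.rpow_nonneg (by linarith) _
  · rw [rlKernel_of_le h]

lemma measurable_rlKernel (β : ℝ) : Measurable fun z : ℝ × ℝ => rlKernel β z.1 z.2 := by
  have : (fun z : ℝ × ℝ => rlKernel β z.1 z.2) =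
      {z : ℝ × ℝ | z.2 < z.1}.indicator fun z => (z.1 - z.2) ^ (β - 1) := by
    ext z
    simp [rlKernel, indicator_apply]
  rw [this]
  refine Measurable.indicator ?_ (measurableSet_lt measurable_snd measurable_fst)
  exact (measurable_fst.sub measurable_snd).pow_const _

lemma measurable_rlKernel_right (β t : ℝ) : Measurable (rlKernel β t) :=
  (measurable_rlKernel β).comp measurable_prodMk_left

lemma leftRLIntegral_eq_integral_rlKernel {d : ℕ} {a b t : ℝ} (ht : t ∈ Icc a b) (β : ℝ)
    (f : ℝ → RR d) :
    leftRLIntegral a β f t =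
      (1 / Real.Gamma β) • ∫ ξ, rlKernel β t ξ • f ξ ∂(intervalMeasure a b) := by
  have h1 : (fun ξ => rlKernel β t ξ • f ξ) =
      (Iio t).indicator fun ξ => (t - ξ) ^ (β - 1) • f ξ := by
    ext1 ξ
    simp only [rlKernel, indicator_apply]
    split_ifs <;> simp
  have h2 : Ioo a b ∩ Iio t = Ioo a t := by
    rw [Ioo_inter_Iio, min_eq_right ht.2]
  rw [leftRLIntegral, intervalIntegral.integral_of_le ht.1, integral_Ioc_eq_integral_Ioo, h1,
    setIntegral_indicator measurableSet_Iio, h2]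

lemma leftRLIntegral_congr_ae {d : ℕ} {a b t : ℝ} (ht : t ∈ Icc a b) (β : ℝ) {f g : ℝ → RR d}
    (h : f =ᵐ[intervalMeasure a b] g) : leftRLIntegral a β f t = leftRLIntegral a β g t := by
  rw [leftRLIntegral_eq_integral_rlKernel ht, leftRLIntegral_eq_integral_rlKernel ht]
  congr 1
  exact integral_congr_ae (h.mono fun ξ hξ => by simp [hξ])

lemma leftRLIntegral_left {d : ℕ} (a β : ℝ) (f : ℝ → RR d) : leftRLIntegral a β f a = 0 := by
  simp [leftRLIntegral]

lemma integrableOn_integral_sub_rpow {κ s t : ℝ} (hκ : 0 < κ) (hst : s ≤ t) :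
    IntegrableOn (fun ξ => (t - ξ) ^ (κ - 1)) (Ioo s t) ∧
      ∫ ξ in Ioo s t, (t - ξ) ^ (κ - 1) = (t - s) ^ κ / κ := by
  constructor
  · have h := ((intervalIntegral.intervalIntegrable_rpow' (a := 0) (b := t - s)
      (r := κ - 1) (by linarith)).comp_sub_left t).symm
    simp only [sub_zero, sub_sub_cancel] at h
    rwa [intervalIntegrable_iff_integrableOn_Ioo_of_le hst] at h
  · rw [← integral_Ioc_eq_integral_Ioo, ← intervalIntegral.integral_of_le hst,
      intervalIntegral.integral_comp_sub_left (fun x => x ^ (κ - 1)),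
      integral_rpow (Or.inl (by linarith))]
    simp [Real.zero_rpow hκ.ne']

lemma integrable_integral_indicator_rlKernel {a b κ s t : ℝ} (hκ : 0 < κ) (has : a ≤ s)
    (hst : s ≤ t) (htb : t ≤ b) :
    Integrable ((Ioi s).indicator (rlKernel κ t)) (intervalMeasure a b) ∧
      ∫ ξ, (Ioi s).indicator (rlKernel κ t) ξ ∂(intervalMeasure a b) = (t - s) ^ κ / κ := by
  have h1 : (Ioi s).indicator (rlKernel κ t) =
      (Ioo s t).indicator fun ξ => (t - ξ) ^ (κ - 1) := by
    ext1 ξ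
    by_cases h : s < ξ <;> by_cases h' : ξ < t <;> simp [rlKernel, h, h']
  have h2 : Ioo a b ∩ Ioo s t = Ioo s t :=
    inter_eq_right.2 (Ioo_subset_Ioo has htb)
  rw [h1]
  have h := integrableOn_integral_sub_rpow hκ hst
  refine ⟨?_, ?_⟩
  · rw [integrable_indicator_iff measurableSet_Ioo, IntegrableOn,
      Measure.restrict_restrict measurableSet_Ioo, inter_comm, h2]
    exact h.1
  · rw [setIntegral_indicator measurableSet_Ioo, h2, h.2]

lemma integrable_integral_rlKernel {a b κ t : ℝ} (hκ : 0 < κ) (ht : t ∈ Icc a b) :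
    Integrable (rlKernel κ t) (intervalMeasure a b) ∧
      ∫ ξ, rlKernel κ t ξ ∂(intervalMeasure a b) = (t - a) ^ κ / κ := by
  have h := integrable_integral_indicator_rlKernel hκ le_rfl ht.1 ht.2
  have h1 : (Ioi a).indicator (rlKernel κ t) =ᵐ[intervalMeasure a b] rlKernel κ t := by
    filter_upwards [ae_restrict_mem measurableSet_Ioo] with ξ hξ
    exact indicator_of_mem (s := Ioi a) hξ.1 _
  exact ⟨h.1.congr h1, (integral_congr_ae h1).symm.trans h.2⟩

/-- To the left of `s` this is superadditivity of `x ^ q`, that is `(A - B)^q ≤ A^q - B^q`. To the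
right of `s` only the kernel at `t` survives, and the factor `2` compensates the minus sign in front
of it. At `ξ = s` the bound fails when `s < t`, whence the exclusion of that null point. -/
lemma rlKernel_sub_rpow_le {α q κ s t ξ : ℝ} (hα : α < 1) (hq : 1 ≤ q) (hκ : κ = (α - 1) * q + 1)
    (hst : s ≤ t) (hξ : ξ ≠ s) :
    |rlKernel α t ξ - rlKernel α s ξ| ^ q ≤
      rlKernel κ s ξ - rlKernel κ t ξ + 2 * (Ioi s).indicator (rlKernel κ t) ξ := by
  have hpow : ∀ x : ℝ, 0 ≤ x → (x ^ (α - 1)) ^ q = x ^ (κ - 1) := by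
    intro x hx
    rw [← Real.rpow_mul hx, hκ]
    congr 1
    ring
  rcases lt_or_gt_of_ne hξ with h | h
  · have hξt : ξ < t := h.trans_le hst
    rw [indicator_of_notMem (by simpa using h.le), rlKernel_of_lt h, rlKernel_of_lt hξt,
      rlKernel_of_lt h, rlKernel_of_lt hξt, ← hpow _ (by linarith), ← hpow _ (by linarith)]
    set A := (s - ξ) ^ (α - 1)
    set B := (t - ξ) ^ (α - 1)
    have hB : 0 ≤ B := Real.rpow_nonneg (by linarith) _
    have hBA : B ≤ A := Real.rpow_le_rpow_of_nonpos (by linarith) (by linarith) (by linarith)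
    have := Real.add_rpow_le_rpow_add (a := A - B) (b := B) (by linarith) hB hq
    rw [abs_sub_comm, abs_of_nonneg (by linarith)]
    rw [sub_add_cancel] at this
    linarith
  · rw [indicator_of_mem (by simpa using h), rlKernel_of_le h.le, rlKernel_of_le h.le]
    rcases lt_or_ge ξ t with h' | h'
    · rw [rlKernel_of_lt h', rlKernel_of_lt h', sub_zero,
        abs_of_nonneg (Real.rpow_nonneg (by linarith) _), hpow _ (by linarith)]
      linarith
    · rw [rlKernel_of_le h', rlKernel_of_le h']
      simp [Real.zero_rpow (show q ≠ 0 by linarith)]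

/-- Integrating the pointwise bound gives `(s - a)^κ / κ - (t - a)^κ / κ + 2 (t - s)^κ / κ`, and the
first difference is nonpositive. -/
lemma memLp_integral_rlKernel_sub {a b α q κ s t : ℝ} (hα : α < 1) (hq : 1 ≤ q)
    (hκ : κ = (α - 1) * q + 1) (hκ0 : 0 < κ) (has : a ≤ s) (hst : s ≤ t) (htb : t ≤ b) :
    MemLp (fun ξ => rlKernel α t ξ - rlKernel α s ξ) (ENNReal.ofReal q) (intervalMeasure a b) ∧
      ∫ ξ, |rlKernel α t ξ - rlKernel α s ξ| ^ q ∂(intervalMeasure a b) ≤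
        2 * (t - s) ^ κ / κ := by
  have hmeas : Measurable (fun ξ => rlKernel α t ξ - rlKernel α s ξ) :=
    (measurable_rlKernel_right α t).sub (measurable_rlKernel_right α s)
  have hs := integrable_integral_rlKernel hκ0 (show s ∈ Icc a b from ⟨has, hst.trans htb⟩)
  have ht := integrable_integral_rlKernel hκ0 (show t ∈ Icc a b from ⟨has.trans hst, htb⟩)
  have hst' := integrable_integral_indicator_rlKernel hκ0 has hst htb
  have hG : Integrable (fun ξ => rlKernel κ s ξ - rlKernel κ t ξ +
      2 * (Ioi s).indicator (rlKernel κ t) ξ) (intervalMeasure a b) :=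
    (hs.1.sub ht.1).add (hst'.1.const_mul 2)
  have hle : ∀ᵐ ξ ∂(intervalMeasure a b), |rlKernel α t ξ - rlKernel α s ξ| ^ q ≤
      rlKernel κ s ξ - rlKernel κ t ξ + 2 * (Ioi s).indicator (rlKernel κ t) ξ := by
    have : ∀ᵐ ξ ∂(intervalMeasure a b), ξ ≠ s :=
      ae_restrict_of_ae (by simp [ae_iff, measure_singleton])
    filter_upwards [this] with ξ hξ
    exact rlKernel_sub_rpow_le hα hq hκ hst hξ
  have hint : Integrable (fun ξ => |rlKernel α t ξ - rlKernel α s ξ| ^ q)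
      (intervalMeasure a b) := by
    refine hG.mono' (hmeas.abs.pow_const q).aestronglyMeasurable ?_
    filter_upwards [hle] with ξ hξ
    rwa [Real.norm_of_nonneg (by positivity)]
  refine ⟨(memLp_ofReal_iff_integrable_rpow (by linarith) hmeas.aestronglyMeasurable).2 hint, ?_⟩
  refine (integral_mono_ae hint hG hle).trans ?_
  have hs' : Integrable (fun ξ => rlKernel κ s ξ - rlKernel κ t ξ) (intervalMeasure a b) :=
    hs.1.sub ht.1
  rw [integral_add hs' (hst'.1.const_mul 2), integral_sub hs.1 ht.1, integral_const_mul,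
    hs.2, ht.2, hst'.2]
  have : (s - a) ^ κ / κ ≤ (t - a) ^ κ / κ := by
    gcongr
  have e : 2 * (t - s) ^ κ / κ = 2 * ((t - s) ^ κ / κ) := by ring
  linarith

/-! ### Fractional integrals of `L^p` functions -/

section LpKernel
variable {d : ℕ} {a b α p : ℝ}

lemma one_lt_of_one_div_lt (hp : 0 < 1 / p) (hpα : 1 / p < α) (hα : α < 1) : 1 < p := by
  have := one_div_pos.1 hp
  rw [div_lt_iff₀ this] at hpα
  nlinarith

/-- With `q` the conjugate exponent, the quantity equals `q (α - 1/p)`. This is where `α > 1/p`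
enters the continuity of `I^α v`. -/
lemma conjExponent_kernel_exponent_pos (hp : 0 < 1 / p) (hpα : 1 / p < α) (hα : α < 1) :
    0 < (α - 1) * p.conjExponent + 1 := by
  have h1 := one_lt_of_one_div_lt hp hpα hα
  have h2 : 0 < p - 1 := by linarith
  rw [Real.conjExponent, ← mul_div_assoc, div_add_one h2.ne']
  refine div_pos ?_ h2
  rw [div_lt_iff₀ (by linarith)] at hpα
  nlinarith

lemma memLp_rlKernel (hp : 0 < 1 / p) (hpα : 1 / p < α) (hα : α < 1) {t : ℝ}
    (ht : t ∈ Icc a b) :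
    MemLp (rlKernel α t) (ENNReal.ofReal p.conjExponent) (intervalMeasure a b) := by
  have hc := Real.HolderConjugate.conjExponent (one_lt_of_one_div_lt hp hpα hα)
  -- Take `s = a` in the difference estimate: the kernel at `a` vanishes on `(a, b)`.
  have h := (memLp_integral_rlKernel_sub hα hc.symm.lt.le rfl
    (conjExponent_kernel_exponent_pos hp hpα hα) le_rfl ht.1 ht.2).1
  refine h.ae_eq ?_
  filter_upwards [ae_restrict_mem measurableSet_Ioo] with ξ hξ
  rw [rlKernel_of_le hξ.1.le, sub_zero]

lemma integrable_rlKernel_smul (hp : 0 < 1 / p) (hpα : 1 / p < α) (hα : α < 1) {t : ℝ}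
    (ht : t ∈ Icc a b) {v : ℝ → RR d} (hv : MemLp v (ENNReal.ofReal p) (intervalMeasure a b)) :
    Integrable (fun ξ => rlKernel α t ξ • v ξ) (intervalMeasure a b) := by
  have hc := Real.HolderConjugate.conjExponent (one_lt_of_one_div_lt hp hpα hα)
  have : ENNReal.HolderTriple (ENNReal.ofReal p.conjExponent) (ENNReal.ofReal p) 1 :=
    hc.symm.ennrealOfReal
  exact memLp_one_iff_integrable.1 (hv.smul (memLp_rlKernel hp hpα hα ht))

lemma leftRLIntegral_combo (hp : 0 < 1 / p) (hpα : 1 / p < α) (hα : α < 1) {t : ℝ}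
    (ht : t ∈ Icc a b) {v w : ℝ → RR d} (hv : MemLp v (ENNReal.ofReal p) (intervalMeasure a b))
    (hw : MemLp w (ENNReal.ofReal p) (intervalMeasure a b)) (x y : ℝ) :
    leftRLIntegral a α (x • v + y • w) t =
      x • leftRLIntegral a α v t + y • leftRLIntegral a α w t := by
  simp only [leftRLIntegral_eq_integral_rlKernel ht]
  have hv' := integrable_rlKernel_smul hp hpα hα ht hv
  have hw' := integrable_rlKernel_smul hp hpα hα ht hw
  have : (fun ξ => rlKernel α t ξ • (x • v + y • w) ξ) =
      fun ξ => x • (rlKernel α t ξ • v ξ) + y • (rlKernel α t ξ • w ξ) := by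
    ext1 ξ
    simp only [Pi.add_apply, Pi.smul_apply, smul_add, smul_comm x, smul_comm y]
  have hxv : Integrable (fun ξ => x • (rlKernel α t ξ • v ξ)) (intervalMeasure a b) := hv'.smul x
  have hyw : Integrable (fun ξ => y • (rlKernel α t ξ • w ξ)) (intervalMeasure a b) := hw'.smul y
  rw [this, integral_add hxv hyw, integral_smul, integral_smul, smul_add, smul_comm _ x,
    smul_comm _ y]

/-- A modulus of continuity for fractional integrals of `L^p` functions when `α > 1 / p`. -/
lemma exists_modulus_leftRLIntegral (hp : 0 < 1 / p) (hpα : 1 / p < α) (hα : α < 1) :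
    ∃ H : ℝ → ℝ, Continuous H ∧ H 0 = 0 ∧ (∀ h, 0 ≤ H h) ∧
      ∀ (d : ℕ) (v : ℝ → RR d), MemLp v (ENNReal.ofReal p) (intervalMeasure a b) →
        ∀ s ∈ Icc a b, ∀ t ∈ Icc a b, ‖leftRLIntegral a α v t - leftRLIntegral a α v s‖ ≤
          H (t - s) * (∫ ξ, ‖v ξ‖ ^ p ∂(intervalMeasure a b)) ^ (1 / p) := by
  have h1p := one_lt_of_one_div_lt hp hpα hα
  have hα0 : 0 < α := hp.trans hpα
  have hΓ : 0 < Real.Gamma α := Real.Gamma_pos_of_pos hα0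
  have hc := Real.HolderConjugate.conjExponent h1p
  have hκ := conjExponent_kernel_exponent_pos hp hpα hα
  set q := p.conjExponent
  set κ := (α - 1) * q + 1 with hκdef
  have hq0 : 0 < q := hc.symm.pos
  refine ⟨fun h => 1 / Real.Gamma α * (2 * |h| ^ κ / κ) ^ (1 / q), ?_, ?_, ?_, ?_⟩
  · have h1 : Continuous fun h : ℝ => |h| ^ κ :=
      (Real.continuous_rpow_const hκ.le).comp continuous_abs
    have h2 : Continuous fun x : ℝ => x ^ (1 / q) := Real.continuous_rpow_const (by positivity)
    exact continuous_const.mul (h2.comp ((continuous_const.mul h1).div_const κ))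
  · simp [Real.zero_rpow hκ.ne', Real.zero_rpow (inv_pos.2 hq0).ne']
  · intro h
    positivity
  · intro d v hv
    have key : ∀ s ∈ Icc a b, ∀ t ∈ Icc a b, s ≤ t →
        ‖leftRLIntegral a α v t - leftRLIntegral a α v s‖ ≤
        1 / Real.Gamma α * (2 * |t - s| ^ κ / κ) ^ (1 / q) *
          (∫ ξ, ‖v ξ‖ ^ p ∂(intervalMeasure a b)) ^ (1 / p) := by
      intro s hs t ht hst
      have hk := memLp_integral_rlKernel_sub hα hc.symm.lt.le hκdef hκ hs.1 hst ht.2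
      have hHol := integral_mul_norm_le_Lp_mul_Lq hc.symm hk.1 hv.norm
      simp only [norm_norm] at hHol
      rw [leftRLIntegral_eq_integral_rlKernel ht, leftRLIntegral_eq_integral_rlKernel hs,
        ← smul_sub, ← integral_sub (integrable_rlKernel_smul hp hpα hα ht hv)
          (integrable_rlKernel_smul hp hpα hα hs hv), norm_smul, Real.norm_of_nonneg
          (by positivity), mul_assoc]
      refine mul_le_mul_of_nonneg_left ?_ (by positivity)
      refine (norm_integral_le_integral_norm _).trans ?_
      simp only [← sub_smul, norm_smul]
      refine hHol.trans ?_
      refine mul_le_mul_of_nonneg_right ?_ (Real.rpow_nonneg (integral_nonneg fun x => by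
        positivity) _)
      refine Real.rpow_le_rpow (integral_nonneg fun x => by positivity) ?_ (by positivity)
      rw [abs_of_nonneg (sub_nonneg.2 hst)]
      exact hk.2
    intro s hs t ht
    rcases le_total s t with h | h
    · exact key s hs t ht h
    · rw [norm_sub_rev]
      have := key t ht s hs h
      rwa [abs_sub_comm] at this

lemma continuousOn_leftRLIntegral (hp : 0 < 1 / p) (hpα : 1 / p < α) (hα : α < 1)
    {v : ℝ → RR d} (hv : MemLp v (ENNReal.ofReal p) (intervalMeasure a b)) :
    ContinuousOn (leftRLIntegral a α v) (Icc a b) := by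
  obtain ⟨H, hHc, hH0, -, hH⟩ := exists_modulus_leftRLIntegral (a := a) (b := b) hp hpα hα
  intro s hs
  rw [ContinuousWithinAt, tendsto_iff_norm_sub_tendsto_zero]
  have hlim : Tendsto (fun t => H (t - s) *
      (∫ ξ, ‖v ξ‖ ^ p ∂(intervalMeasure a b)) ^ (1 / p)) (𝓝[Icc a b] s) (𝓝 0) := by
    have : Continuous fun t => H (t - s) *
      (∫ ξ, ‖v ξ‖ ^ p ∂(intervalMeasure a b)) ^ (1 / p) := by fun_prop
    have := (this.tendsto s).mono_left (nhdsWithin_le_nhds (s := Icc a b))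
    simpa [hH0] using this
  refine squeeze_zero' (Eventually.of_forall fun _ => norm_nonneg _) ?_ hlim
  filter_upwards [self_mem_nhdsWithin] with t ht
  exact hH d v hv s hs t ht

end LpKernel

/-! ### Beta integral, semigroup property and inversion -/

/-- The real form of the Beta integral `B(α, 1 - α)` over an arbitrary interval. -/
lemma integrableOn_integral_rpow_mul_rpow {α ξ t : ℝ} (hα0 : 0 < α) (hα : α < 1) (h : ξ < t) :
    IntegrableOn (fun s => (t - s) ^ (1 - α - 1) * (s - ξ) ^ (α - 1)) (Ioo ξ t) ∧
      ∫ s in Ioo ξ t, (t - s) ^ (1 - α - 1) * (s - ξ) ^ (α - 1) =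
        Real.Gamma α * Real.Gamma (1 - α) := by
  have hc : 0 < t - ξ := sub_pos.2 h
  have hpos : 0 < Real.Gamma α * Real.Gamma (1 - α) :=
    mul_pos (Real.Gamma_pos_of_pos hα0) (Real.Gamma_pos_of_pos (by linarith))
  have h0 : ∫ x in (0 : ℝ)..(t - ξ), x ^ (α - 1) * (t - ξ - x) ^ (1 - α - 1) =
      Real.Gamma α * Real.Gamma (1 - α) := by
    have hB := Complex.betaIntegral_scaled (α : ℂ) ((1 - α : ℝ) : ℂ) hc
    have hG := Complex.Gamma_mul_Gamma_eq_betaIntegral (s := (α : ℂ)) (t := ((1 - α : ℝ) : ℂ))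
      (by simpa using hα0) (by simpa using hα)
    have hsum : (α : ℂ) + ((1 - α : ℝ) : ℂ) = 1 := by push_cast; ring
    rw [hsum, Complex.Gamma_one, one_mul] at hG
    rw [hsum, sub_self, Complex.cpow_zero, one_mul, ← hG, Complex.Gamma_ofReal,
      Complex.Gamma_ofReal] at hB
    have hcast : ∫ x in (0 : ℝ)..(t - ξ), (x : ℂ) ^ ((α : ℂ) - 1) *
        (((t - ξ : ℝ) : ℂ) - x) ^ (((1 - α : ℝ) : ℂ) - 1) =
        ∫ x in (0 : ℝ)..(t - ξ), ((x ^ (α - 1) * (t - ξ - x) ^ (1 - α - 1) : ℝ) : ℂ) := by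
      refine intervalIntegral.integral_congr fun x hx => ?_
      rw [uIcc_of_le hc.le] at hx
      rw [Complex.ofReal_mul, Complex.ofReal_cpow hx.1,
        Complex.ofReal_cpow (by linarith [hx.2])]
      push_cast
      rfl
    rw [hcast, intervalIntegral.integral_ofReal] at hB
    exact_mod_cast hB
  have h1 : ∫ s in ξ..t, (t - s) ^ (1 - α - 1) * (s - ξ) ^ (α - 1) =
      Real.Gamma α * Real.Gamma (1 - α) := by
    have := intervalIntegral.integral_comp_sub_right
      (fun x => x ^ (α - 1) * (t - ξ - x) ^ (1 - α - 1)) ξ (a := ξ) (b := t)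
    rw [sub_self, h0] at this
    rw [← this]
    refine intervalIntegral.integral_congr fun s _ => ?_
    rw [mul_comm]
    congr 2
    ring
  -- A non-integrable function would have integral `0` by convention, which contradicts the positive
  -- value just computed.
  have h2 : IntervalIntegrable (fun s => (t - s) ^ (1 - α - 1) * (s - ξ) ^ (α - 1)) volume ξ t := by
    by_contra hcon
    rw [intervalIntegral.integral_undef hcon] at h1
    linarith
  refine ⟨(intervalIntegrable_iff_integrableOn_Ioo_of_le h.le).1 h2, ?_⟩
  rw [← integral_Ioc_eq_integral_Ioo, ← intervalIntegral.integral_of_le h.le, h1]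

/-- For `ξ < t` the Beta integral does not depend on `ξ` or `t`, so composing the two kernels yields
a constant multiple of the kernel of `I^1`. -/
lemma integrable_integral_rlKernel_mul_rlKernel {a b α ξ t : ℝ} (hα0 : 0 < α) (hα : α < 1)
    (haξ : a ≤ ξ) (htb : t ≤ b) :
    Integrable (fun s => rlKernel (1 - α) t s * rlKernel α s ξ) (intervalMeasure a b) ∧
      ∫ s, rlKernel (1 - α) t s * rlKernel α s ξ ∂(intervalMeasure a b) =
        (Iio t).indicator (fun _ => Real.Gamma α * Real.Gamma (1 - α)) ξ := by
  have h1 : (fun s => rlKernel (1 - α) t s * rlKernel α s ξ) =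
      (Ioo ξ t).indicator fun s => (t - s) ^ (1 - α - 1) * (s - ξ) ^ (α - 1) := by
    ext1 s
    by_cases h : ξ < s <;> by_cases h' : s < t <;> simp [rlKernel, h, h']
  rw [h1]
  rcases lt_or_ge ξ t with h | h
  · have h2 : Ioo a b ∩ Ioo ξ t = Ioo ξ t := inter_eq_right.2 (Ioo_subset_Ioo haξ htb)
    have hB := integrableOn_integral_rpow_mul_rpow hα0 hα h
    constructor
    · rw [integrable_indicator_iff measurableSet_Ioo, IntegrableOn,
        Measure.restrict_restrict measurableSet_Ioo, inter_comm, h2]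
      exact hB.1
    · rw [setIntegral_indicator measurableSet_Ioo, h2, hB.2, indicator_of_mem (by simpa using h)]
  · rw [Ioo_eq_empty (not_lt.2 h), indicator_empty, indicator_of_notMem (by simpa using h)]
    exact ⟨integrable_zero _ _ _, by simp⟩

/-- The semigroup property `I^(1 - α) (I^α v) = I^1 v`. -/
lemma leftRLIntegral_leftRLIntegral {d : ℕ} {a b α : ℝ} (hα0 : 0 < α) (hα : α < 1)
    {v : ℝ → RR d} (hv : Integrable v (intervalMeasure a b)) {t : ℝ} (ht : t ∈ Icc a b) :
    leftRLIntegral a (1 - α) (leftRLIntegral a α v) t = ∫ ξ in a..t, v ξ := by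
  set μ := intervalMeasure a b with hμ
  set c := Real.Gamma α * Real.Gamma (1 - α) with hc
  have hΓ1 : 0 < Real.Gamma α := Real.Gamma_pos_of_pos hα0
  have hΓ2 : 0 < Real.Gamma (1 - α) := Real.Gamma_pos_of_pos (by linarith)
  have hprod : Integrable (Function.uncurry fun s ξ =>
      (rlKernel (1 - α) t s * rlKernel α s ξ) • v ξ) (μ.prod μ) := by
    have hmeas : AEStronglyMeasurable (Function.uncurry fun s ξ =>
        (rlKernel (1 - α) t s * rlKernel α s ξ) • v ξ) (μ.prod μ) := by
      have hk : Measurable fun z : ℝ × ℝ => rlKernel (1 - α) t z.1 * rlKernel α z.1 z.2 :=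
        ((measurable_rlKernel_right (1 - α) t).comp measurable_fst).mul (measurable_rlKernel α)
      exact hk.aestronglyMeasurable.smul hv.1.comp_snd
    rw [integrable_prod_iff' hmeas]
    constructor
    · filter_upwards [ae_restrict_mem measurableSet_Ioo] with ξ hξ
      exact (integrable_integral_rlKernel_mul_rlKernel hα0 hα hξ.1.le ht.2).1.smul_const (v ξ)
    -- The kernels are nonnegative, so integrating the norm in `s` first gives `c ‖v ξ‖` cut off at
    -- `t`. This justifies Fubini for `v` merely integrable.
    · have hI : Integrable (fun ξ => (Iio t).indicator (fun _ => c) ξ * ‖v ξ‖) μ := by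
        have := (hv.norm.const_mul c).indicator (measurableSet_Iio (a := t))
        refine this.congr (Eventually.of_forall fun ξ => ?_)
        by_cases h : ξ < t <;> simp [h]
      refine hI.congr ?_
      filter_upwards [ae_restrict_mem measurableSet_Ioo] with ξ hξ
      rw [← (integrable_integral_rlKernel_mul_rlKernel (b := b) hα0 hα hξ.1.le ht.2).2,
        ← integral_mul_const]
      refine integral_congr_ae (Eventually.of_forall fun s => ?_)
      simp only [Function.uncurry_apply_pair, norm_smul]
      rw [Real.norm_of_nonneg (mul_nonneg (rlKernel_nonneg _ _ _) (rlKernel_nonneg _ _ _))]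
  rw [leftRLIntegral_eq_integral_rlKernel ht]
  have h1 : ∫ s, rlKernel (1 - α) t s • leftRLIntegral a α v s ∂μ =
      ∫ s, (1 / Real.Gamma α) • ∫ ξ, (rlKernel (1 - α) t s * rlKernel α s ξ) • v ξ ∂μ ∂μ := by
    refine integral_congr_ae ?_
    filter_upwards [ae_restrict_mem measurableSet_Ioo] with s hs
    rw [leftRLIntegral_eq_integral_rlKernel ⟨hs.1.le, hs.2.le⟩, smul_comm, ← integral_smul]
    simp only [mul_smul, hμ]
  have h2 : ∫ ξ, ∫ s, (rlKernel (1 - α) t s * rlKernel α s ξ) • v ξ ∂μ ∂μ =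
      ∫ ξ, c • (Iio t).indicator v ξ ∂μ := by
    refine integral_congr_ae ?_
    filter_upwards [ae_restrict_mem measurableSet_Ioo] with ξ hξ
    rw [integral_smul_const, (integrable_integral_rlKernel_mul_rlKernel hα0 hα hξ.1.le ht.2).2]
    by_cases h : ξ < t <;> simp [h, hc]
  have h3 : Ioo a b ∩ Iio t = Ioo a t := by rw [Ioo_inter_Iio, min_eq_right ht.2]
  rw [h1, integral_smul, integral_integral_swap hprod, h2, integral_smul,
    setIntegral_indicator measurableSet_Iio, h3, intervalIntegral.integral_of_le ht.1,
    integral_Ioc_eq_integral_Ioo, smul_smul, smul_smul]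
  convert one_smul ℝ _
  rw [hc]
  field_simp

/-- The fractional derivative inverts the fractional integral almost everywhere. -/
lemma ae_hasDerivAt_leftRLIntegral {d : ℕ} {a b α : ℝ} (hab : a < b) (hα0 : 0 < α) (hα : α < 1)
    {v u : ℝ → RR d} (hv : Integrable v (intervalMeasure a b))
    (hu : leftRLIntegral a α v =ᵐ[intervalMeasure a b] u) :
    ∀ᵐ t ∂(intervalMeasure a b), HasDerivAt (leftRLIntegral a (1 - α) u) (v t) t := by
  have hv' : IntervalIntegrable v volume a b :=
    (intervalIntegrable_iff_integrableOn_Ioo_of_le hab.le).2 hv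
  filter_upwards [ae_restrict_mem measurableSet_Ioo,
    ae_restrict_of_ae hv'.ae_hasDerivAt_integral] with t ht hd
  rw [uIcc_of_le hab.le] at hd
  have hd' := hd ⟨ht.1.le, ht.2.le⟩ a ⟨le_rfl, hab.le⟩
  refine hd'.congr_of_eventuallyEq ?_
  filter_upwards [Ioo_mem_nhds ht.1 ht.2] with s hs
  have hs' : s ∈ Icc a b := ⟨hs.1.le, hs.2.le⟩
  rw [← leftRLIntegral_congr_ae hs' _ hu, leftRLIntegral_leftRLIntegral hα0 hα hv hs']

/-! ### The space `E_{α,p}` as the range of `I^α` on `L^p` -/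

section fracSpace
variable {d : ℕ} {a b α p : ℝ}

lemma memLp_leftRLIntegral (hp : 0 < 1 / p) (hpα : 1 / p < α) (hα : α < 1)
    {v : ℝ → RR d} (hv : MemLp v (ENNReal.ofReal p) (intervalMeasure a b)) :
    MemLp (leftRLIntegral a α v) (ENNReal.ofReal p) (intervalMeasure a b) := by
  have hc := continuousOn_leftRLIntegral hp hpα hα hv
  obtain ⟨C, hC⟩ := isCompact_Icc.exists_bound_of_continuousOn hc
  refine MemLp.of_bound ((hc.mono Ioo_subset_Icc_self).aestronglyMeasurable measurableSet_Ioo) C ?_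
  filter_upwards [ae_restrict_mem measurableSet_Ioo] with t ht
  exact hC t (Ioo_subset_Icc_self ht)

/-- Every fractional integral of an `L^p` function belongs to `E_{α,p}`. -/
lemma exists_mem_fracSpace (hab : a < b) (hp : 0 < 1 / p) (hpα : 1 / p < α) (hα : α < 1)
    {v : ℝ → RR d} (hv : MemLp v (ENNReal.ofReal p) (intervalMeasure a b)) :
    ∃ u ∈ fracSpace d a b α p, leftRLDeriv a α u =ᵐ[intervalMeasure a b] v ∧
      leftRLIntegral a α v =ᵐ[intervalMeasure a b] u := by
  have hα0 : 0 < α := hp.trans hpα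
  have h1p := one_lt_of_one_div_lt hp hpα hα
  have hvi : Integrable v (intervalMeasure a b) :=
    hv.integrable (by rw [← ENNReal.ofReal_one]; exact ENNReal.ofReal_le_ofReal h1p.le)
  let u : LpInterval d a b p := (memLp_leftRLIntegral hp hpα hα hv).toLp _
  have hu : leftRLIntegral a α v =ᵐ[intervalMeasure a b] u := (MemLp.coeFn_toLp _).symm
  have hD := ae_hasDerivAt_leftRLIntegral hab hα0 hα hvi hu
  have hDv : leftRLDeriv a α u =ᵐ[intervalMeasure a b] v := hD.mono fun t ht => ht.deriv
  refine ⟨u, ⟨hD.mono fun t ht => ht.differentiableAt, (memLp_congr_ae hDv).2 hv, ?_⟩, hDv, hu⟩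
  refine EventuallyEq.trans ?_ hu
  filter_upwards [ae_restrict_mem measurableSet_Ioo] with t ht
  exact leftRLIntegral_congr_ae (Ioo_subset_Icc_self ht) _ hDv

/-- Pointwise convergence of fractional integrals along an almost everywhere convergent sequence
which is bounded in `L^p`. -/
lemma tendsto_leftRLIntegral_of_tendsto_ae (hp : 0 < 1 / p) (hpα : 1 / p < α) (hα : α < 1)
    {w : ℕ → ℝ → RR d} {v : ℝ → RR d} {M : ℝ}
    (hw : ∀ k, MemLp (w k) (ENNReal.ofReal p) (intervalMeasure a b))
    (hv : MemLp v (ENNReal.ofReal p) (intervalMeasure a b))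
    (hM : ∀ k, ∫ x, ‖w k x‖ ^ p ∂(intervalMeasure a b) ≤ M)
    (hvM : ∫ x, ‖v x‖ ^ p ∂(intervalMeasure a b) ≤ M)
    (hlim : ∀ᵐ x ∂(intervalMeasure a b), Tendsto (fun k => w k x) atTop (𝓝 (v x)))
    {t : ℝ} (ht : t ∈ Icc a b) :
    Tendsto (fun k => leftRLIntegral a α (w k) t) atTop (𝓝 (leftRLIntegral a α v t)) := by
  have h1p := one_lt_of_one_div_lt hp hpα hα
  have hp0 : 0 < p := by linarith
  simp only [leftRLIntegral_eq_integral_rlKernel ht]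
  refine Tendsto.const_smul ?_ _
  refine tendsto_integral_smul_of_tendsto_ae (M := 2 ^ (p - 1) * (M + M))
    (Real.HolderConjugate.conjExponent h1p) (memLp_rlKernel hp hpα hα ht) hw hv (fun k => ?_) hlim
  have hwp := (memLp_ofReal_iff_integrable_rpow hp0 (hw k).1).1 (hw k)
  have hvp := (memLp_ofReal_iff_integrable_rpow hp0 hv.1).1 hv
  have hwvp := (memLp_ofReal_iff_integrable_rpow hp0 ((hw k).sub hv).1).1 ((hw k).sub hv)
  calc ∫ x, ‖w k x - v x‖ ^ p ∂(intervalMeasure a b)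
      ≤ ∫ x, 2 ^ (p - 1) * (‖w k x‖ ^ p + ‖v x‖ ^ p) ∂(intervalMeasure a b) := by
        refine integral_mono hwvp ((hwp.add hvp).const_mul _) fun x => ?_
        have h1 := Real.rpow_le_rpow (norm_nonneg _) (norm_sub_le (w k x) (v x)) hp0.le
        have h2 := NNReal.rpow_add_le_mul_rpow_add_rpow ‖w k x‖₊ ‖v x‖₊ h1p.le
        exact h1.trans (by exact_mod_cast h2)
    _ ≤ _ := by
        rw [integral_const_mul, integral_add hwp hvp]
        gcongr
        exact hM k

end fracSpace

/-! ### Compactness in the uniform norm -/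

/-- A uniform bound and a common modulus of continuity on a compact interval yield a
uniformly convergent subsequence (Arzelà–Ascoli). -/
lemma exists_subseq_tendstoUniformlyOn_Icc {d : ℕ} {a b R : ℝ} {f : ℕ → ℝ → RR d} {H : ℝ → ℝ}
    (hH : Continuous H) (hH0 : H 0 = 0)
    (hf : ∀ n, ∀ s ∈ Icc a b, ∀ t ∈ Icc a b, ‖f n t - f n s‖ ≤ H (t - s))
    (hR : ∀ n, ∀ t ∈ Icc a b, ‖f n t‖ ≤ R) :
    ∃ φ : ℕ → ℕ, StrictMono φ ∧ ∃ u : ℝ → RR d, ContinuousOn u (Icc a b) ∧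
      ∀ ε > 0, ∃ N, ∀ n ≥ N, ∀ t ∈ Icc a b, ‖f (φ n) t - u t‖ ≤ ε := by
  have hlim : ∀ s : ℝ, Tendsto (fun t => H (t - s)) (𝓝 s) (𝓝 0) := by
    intro s
    have : Continuous fun t => H (t - s) := by fun_prop
    simpa [hH0] using this.tendsto s
  have hc : ∀ n, ContinuousOn (f n) (Icc a b) := by
    intro n s hs
    rw [ContinuousWithinAt, tendsto_iff_norm_sub_tendsto_zero]
    refine squeeze_zero' (Eventually.of_forall fun _ => norm_nonneg _) ?_
      ((hlim s).mono_left nhdsWithin_le_nhds)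
    filter_upwards [self_mem_nhdsWithin] with t ht
    exact hf n s hs t ht
  let F : ℕ → BoundedContinuousFunction (Icc a b) (RR d) := fun n =>
    BoundedContinuousFunction.mkOfCompact ⟨fun t => f n t, continuousOn_iff_continuous_domRestrict.1 (hc n)⟩
  have hcpt : IsCompact (closure (range F)) := by
    refine BoundedContinuousFunction.arzela_ascoli (Metric.closedBall 0 R)
      (isCompact_closedBall _ _) _ ?_ ?_
    · rintro _ t ⟨n, rfl⟩
      exact mem_closedBall_zero_iff.2 (hR n t t.2)
    · intro s
      rw [Metric.equicontinuousAt_iff]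
      intro ε hε
      have hcoe : Tendsto (fun t : Icc a b => H ((t : ℝ) - s)) (𝓝 s) (𝓝 0) :=
        (hlim s).comp continuous_subtype_val.continuousAt
      obtain ⟨δ, hδ, h⟩ := Metric.eventually_nhds_iff.1 (hcoe.eventually (gt_mem_nhds hε))
      refine ⟨δ, hδ, ?_⟩
      rintro t ht ⟨_, n, rfl⟩
      have h1 := hf n s s.2 t t.2
      rw [dist_comm, dist_eq_norm]
      exact h1.trans_lt (h ht)
  obtain ⟨U, -, φ, hφ, hU⟩ := hcpt.tendsto_subseq (x := F) fun n => subset_closure ⟨n, rfl⟩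
  refine ⟨φ, hφ, fun t => if h : t ∈ Icc a b then U ⟨t, h⟩ else 0, ?_, ?_⟩
  · rw [continuousOn_iff_continuous_domRestrict]
    refine U.continuous.congr fun t => ?_
    change U t = if h : (t : ℝ) ∈ Icc a b then U ⟨t, h⟩ else 0
    rw [dif_pos t.2]
  · intro ε hε
    obtain ⟨N, hN⟩ := (Metric.tendsto_atTop.1 hU) ε hε
    refine ⟨N, fun n hn t ht => ?_⟩
    have h1 := (BoundedContinuousFunction.dist_coe_le_dist (f := F (φ n)) (g := U) ⟨t, ht⟩).trans
      (hN n hn).le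
    rw [dist_eq_norm] at h1
    beta_reduce
    rw [dif_pos ht]
    exact h1

/-! ### Consequences of the growth hypotheses -/

section Lagrangian
variable {d : ℕ} {a b p : ℝ} {L : RR d → RR d → ℝ → ℝ}

lemma ContinuousOn.exists_bound_comp_Icc {r : RR d → ℝ → ℝ}
    (hr : ContinuousOn (fun z : RR d × ℝ => r z.1 z.2) (univ ×ˢ Icc a b)) (R : ℝ) :
    ∃ C, 0 ≤ C ∧ ∀ x : RR d, ‖x‖ ≤ R → ∀ t ∈ Icc a b, |r x t| ≤ C := by
  obtain ⟨C, hC⟩ := ((isCompact_closedBall (0 : RR d) R).prod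
    (isCompact_Icc (a := a) (b := b))).exists_bound_of_continuousOn
    (hr.mono (prod_mono (subset_univ _) Subset.rfl))
  refine ⟨max C 0, le_max_right _ _, fun x hx t ht => (hC (x, t) ⟨by simpa using hx, ht⟩).trans
    (le_max_left _ _)⟩

lemma LagrangianC1.continuousOn (hL : LagrangianC1 a b L) :
    ContinuousOn (fun z : RR d × RR d × ℝ => L z.1 z.2.1 z.2.2) (univ ×ˢ (univ ×ˢ Icc a b)) :=
  ContDiffOn.continuousOn hL

lemma LagrangianC1.continuous_snd (hL : LagrangianC1 a b L) (x : RR d) {t : ℝ}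
    (ht : t ∈ Icc a b) : Continuous fun y => L x y t := by
  rw [← continuousOn_univ]
  exact hL.continuousOn.comp (f := fun y => (x, y, t)) (by fun_prop)
    fun y _ => ⟨mem_univ _, mem_univ _, ht⟩

lemma LagrangianC1.differentiable_fst (hL : LagrangianC1 a b L) (y : RR d) {t : ℝ}
    (ht : t ∈ Icc a b) : Differentiable ℝ fun x => L x y t := by
  rw [← differentiableOn_univ]
  exact (ContDiffOn.differentiableOn hL one_ne_zero).comp (f := fun x => (x, y, t))
    (by fun_prop) fun x _ => ⟨mem_univ _, mem_univ _, ht⟩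

lemma LagrangianC1.aestronglyMeasurable_comp (hL : LagrangianC1 a b L) {x w : ℝ → RR d}
    (hx : AEStronglyMeasurable x (intervalMeasure a b))
    (hw : AEStronglyMeasurable w (intervalMeasure a b)) :
    AEStronglyMeasurable (fun t => L (x t) (w t) t) (intervalMeasure a b) := by
  have hS : MeasurableSet (univ ×ˢ (univ ×ˢ Icc a b) : Set (RR d × RR d × ℝ)) :=
    MeasurableSet.univ.prod (MeasurableSet.univ.prod measurableSet_Icc)
  -- Continuity is known only for `t ∈ [a, b]`, so the Lagrangian is extended by zero to a Borel
  -- function on the whole space.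
  have hG : Measurable ((univ ×ˢ (univ ×ˢ Icc a b) : Set (RR d × RR d × ℝ)).indicator
      fun z => L z.1 z.2.1 z.2.2) := by
    classical
    rw [← piecewise_eq_indicator]
    exact hL.continuousOn.measurable_piecewise continuousOn_const hS
  have hz : AEMeasurable (fun t => (x t, w t, t)) (intervalMeasure a b) :=
    hx.aemeasurable.prodMk (hw.aemeasurable.prodMk aemeasurable_id)
  refine (hG.comp_aemeasurable hz).aestronglyMeasurable.congr ?_
  filter_upwards [ae_restrict_mem measurableSet_Ioo] with t ht
  exact indicator_of_mem (show (x t, w t, t) ∈ univ ×ˢ (univ ×ˢ Icc a b) from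
    ⟨mem_univ _, mem_univ _, Ioo_subset_Icc_self ht⟩) _

lemma rpow_le_one_add_rpow {x r s : ℝ} (hx : 0 ≤ x) (hr : 0 ≤ r) (hrs : r ≤ s) :
    x ^ r ≤ 1 + x ^ s := by
  have : 0 ≤ x ^ s := by positivity
  rcases le_total x 1 with h | h
  · linarith [Real.rpow_le_one hx h hr]
  · linarith [Real.rpow_le_rpow_of_exponent_le h hrs]

/-- The Lagrangian has growth of order `p` in its second variable, locally uniformly in the
first one. -/
lemma HypH1.exists_bound (h1 : HypH1 a b p L) (hL : LagrangianC1 a b L) (R : ℝ) :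
    ∃ C, 0 ≤ C ∧ ∀ x : RR d, ‖x‖ ≤ R → ∀ y : RR d, ∀ t ∈ Icc a b,
      |L x y t| ≤ C * (1 + ‖y‖ ^ p) := by
  obtain ⟨d₁, r, s, hd0, hdp, hr, hs, h⟩ := h1
  have h0 : ContinuousOn (fun z : RR d × ℝ => L z.1 0 z.2) (univ ×ˢ Icc a b) :=
    hL.continuousOn.comp (f := fun z : RR d × ℝ => (z.1, (0 : RR d), z.2)) (by fun_prop)
      fun z hz => ⟨mem_univ _, mem_univ _, hz.2⟩
  obtain ⟨C₀, hC₀, hL0⟩ :=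
    ContinuousOn.exists_bound_comp_Icc (r := fun x t => L x 0 t) h0 R
  obtain ⟨C₁, hC₁, hr1⟩ := hr.1.exists_bound_comp_Icc R
  obtain ⟨C₂, hC₂, hs1⟩ := hs.1.exists_bound_comp_Icc R
  refine ⟨C₀ + C₁ + C₂, by positivity, fun x hx y t ht => ?_⟩
  have e0 := abs_le.1 (hL0 x hx t ht)
  have e1 := (le_abs_self _).trans (hr1 x hx t ht)
  have e2 := (le_abs_self _).trans (hs1 x hx t ht)
  have e3 := abs_le.1 (h x y t ht)
  have e4 := rpow_le_one_add_rpow (norm_nonneg y) hd0 hdp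
  have e5 : 0 ≤ ‖y‖ ^ d₁ := by positivity
  have e6 : 0 ≤ ‖y‖ ^ p := by positivity
  have e7 : r x t * ‖y‖ ^ d₁ ≤ C₁ * (1 + ‖y‖ ^ p) := mul_le_mul e1 e4 e5 hC₁
  have e8 := mul_nonneg hC₀ e6
  have e9 := mul_nonneg hC₂ e6
  rw [abs_le]
  constructor <;> nlinarith

lemma HypH1.integrable_comp (h1 : HypH1 a b p L) (hL : LagrangianC1 a b L) (hp : 0 < p)
    {x w : ℝ → RR d} (hx : ContinuousOn x (Icc a b))
    (hw : MemLp w (ENNReal.ofReal p) (intervalMeasure a b)) :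
    Integrable (fun t => L (x t) (w t) t) (intervalMeasure a b) := by
  obtain ⟨R, hR⟩ := isCompact_Icc.exists_bound_of_continuousOn hx
  obtain ⟨C, hC, h⟩ := h1.exists_bound hL R
  refine Integrable.mono' (((integrable_const (1 : ℝ)).add
    ((memLp_ofReal_iff_integrable_rpow hp hw.1).1 hw)).const_mul C)
    (hL.aestronglyMeasurable_comp ((hx.mono Ioo_subset_Icc_self).aestronglyMeasurable
      measurableSet_Ioo) hw.1) ?_
  filter_upwards [ae_restrict_mem measurableSet_Ioo] with t ht
  have ht' := Ioo_subset_Icc_self ht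
  exact h _ (hR t ht') _ t ht'

/-- Local Lipschitz dependence of the Lagrangian on its first variable. -/
lemma HypH2.exists_lipschitz (h2 : HypH2 a b p L) (hL : LagrangianC1 a b L) (R : ℝ) :
    ∃ C, 0 ≤ C ∧ ∀ x : RR d, ‖x‖ ≤ R → ∀ x' : RR d, ‖x'‖ ≤ R → ∀ y : RR d, ∀ t ∈ Icc a b,
      |L x' y t - L x y t| ≤ C * (1 + ‖y‖ ^ p) * ‖x' - x‖ := by
  obtain ⟨d₂, r, s, hd0, hdp, hr, hs, h⟩ := h2
  obtain ⟨C₁, hC₁, hr1⟩ := hr.1.exists_bound_comp_Icc R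
  obtain ⟨C₂, hC₂, hs1⟩ := hs.1.exists_bound_comp_Icc R
  refine ⟨C₁ + C₂, by positivity, fun x hx x' hx' y t ht => ?_⟩
  refine Convex.norm_image_sub_le_of_norm_fderiv_le (𝕜 := ℝ) (f := fun x => L x y t)
    (s := Metric.closedBall 0 R) (fun z _ => (hL.differentiable_fst y ht) z) (fun z hz => ?_)
    (convex_closedBall _ _) (by simpa using hx) (by simpa using hx')
  have hz' : ‖z‖ ≤ R := by simpa using hz
  have e1 := (le_abs_self _).trans (hr1 z hz' t ht)
  have e2 := (le_abs_self _).trans (hs1 z hz' t ht)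
  have e4 := rpow_le_one_add_rpow (norm_nonneg y) hd0 hdp
  have e5 : 0 ≤ ‖y‖ ^ d₂ := by positivity
  have e6 : 0 ≤ ‖y‖ ^ p := by positivity
  have e7 : r z t * ‖y‖ ^ d₂ ≤ C₁ * (1 + ‖y‖ ^ p) := mul_le_mul e1 e4 e5 hC₁
  have e9 := mul_nonneg hC₂ e6
  refine (h z y t ht).trans ?_
  nlinarith

lemma HypH4.exists_lower_bound (h4 : HypH4 a b p L) :
    ∃ γ r A B : ℝ, 0 < γ ∧ 0 ≤ r ∧ r < p ∧ 0 ≤ A ∧ ∀ x y : RR d, ∀ t ∈ Icc a b,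
      γ * ‖y‖ ^ p - A * ‖x‖ ^ r - B ≤ L x y t := by
  obtain ⟨γ, d₄, c₁, c₂, c₃, hγ, hd1, hdp, hc₁, hc₂, hc₃, h⟩ := h4
  obtain ⟨A, hA⟩ := isCompact_Icc.exists_bound_of_continuousOn hc₂
  obtain ⟨B, hB⟩ := isCompact_Icc.exists_bound_of_continuousOn hc₃
  refine ⟨γ, d₄, max A 0, B, hγ, by linarith, hdp, le_max_right _ _, fun x y t ht => ?_⟩
  have e1 := hc₁.2 x t ht
  have e2 := neg_le_of_abs_le ((hA t ht).trans (le_max_left A 0))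
  have e3 := neg_le_of_abs_le (hB t ht)
  have e4 : 0 ≤ ‖y‖ ^ p := by positivity
  have e5 : 0 ≤ ‖x‖ ^ d₄ := by positivity
  have e6 := mul_le_mul_of_nonneg_right e1 e4
  have e7 := mul_le_mul_of_nonneg_right e2 e5
  linarith [h x y t ht]

lemma hypH5''_of_hypH5 (h : HypH5 a b L) : HypH5'' a b L := by
  intro x t ht
  refine ⟨convex_univ, fun y _ z _ r s hr hs hrs => ?_⟩
  have := (h t ht).2 (mem_univ (x, y)) (mem_univ (x, z)) hr hs hrs
  simpa [← add_smul, hrs] using this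

end Lagrangian

/-- Sublinear powers are absorbed by an arbitrarily small linear term. Used with `θ = r / p < 1` to
absorb the negative part of the lower bound for the Lagrangian. -/
lemma exists_rpow_le_mul_add {θ ε : ℝ} (hθ0 : 0 ≤ θ) (hθ : θ < 1) (hε : 0 < ε) :
    ∃ C, ∀ x : ℝ, 0 ≤ x → x ^ θ ≤ ε * x + C := by
  obtain ⟨N, hN⟩ := eventually_atTop.1
    ((tendsto_rpow_neg_atTop (sub_pos.2 hθ)).eventually (gt_mem_nhds hε))
  refine ⟨(max N 1) ^ θ, fun x hx => ?_⟩
  have h0 : 0 ≤ (max N 1) ^ θ := by positivity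
  rcases le_total (max N 1) x with h' | h'
  · have h1 := hN x ((le_max_left _ _).trans h')
    have hx0 : 0 < x := one_pos.trans_le ((le_max_right _ _).trans h')
    have h2 : x ^ θ = x ^ (-(1 - θ)) * x := by
      rw [← Real.rpow_add_one hx0.ne']
      congr 1
      ring
    rw [h2]
    nlinarith
  · have h1 : x ^ θ ≤ (max N 1) ^ θ := Real.rpow_le_rpow hx h' hθ0
    have : 0 ≤ ε * x := by positivity
    linarith

/-! ### The direct method -/

section Minimization
variable {d : ℕ} {a b α p : ℝ} {L : RR d → RR d → ℝ → ℝ}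

lemma intervalMeasure_real_univ (hab : a < b) : (intervalMeasure a b).real univ = b - a := by
  simp [hab.le]

/-- The functional in terms of the density `v`, with `u = I^α v`, is coercive on `L^p`. -/
lemma exists_coercive_bound (hab : a < b) (hp : 0 < 1 / p) (hpα : 1 / p < α) (hα : α < 1)
    (hL : LagrangianC1 a b L) (h1 : HypH1 a b p L) (h4 : HypH4 a b p L) :
    ∃ γ > 0, ∃ C, ∀ v : ℝ → RR d, MemLp v (ENNReal.ofReal p) (intervalMeasure a b) →
      γ * (∫ t, ‖v t‖ ^ p ∂(intervalMeasure a b)) - C ≤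
        ∫ t, L (leftRLIntegral a α v t) (v t) t ∂(intervalMeasure a b) := by
  have h1p := one_lt_of_one_div_lt hp hpα hα
  have hp0 : 0 < p := by linarith
  obtain ⟨γ, r, A, B, hγ, hr, hrp, hA, h⟩ := h4.exists_lower_bound
  obtain ⟨H, hHc, hH0, hHpos, hH⟩ := exists_modulus_leftRLIntegral (a := a) (b := b) hp hpα hα
  obtain ⟨K, hK⟩ := isCompact_Icc.exists_bound_of_continuousOn
    (show ContinuousOn (fun t => H (t - a)) (Icc a b) by fun_prop)
  have hK0 : 0 ≤ K := (norm_nonneg _).trans (hK a ⟨le_rfl, hab.le⟩)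
  let A' : ℝ := A * K ^ r * (b - a)
  have hA' : 0 ≤ A' := mul_nonneg (mul_nonneg hA (by positivity)) (by linarith)
  -- This `ε` makes `A' ε ≤ γ / 2`, so half of the coercive term survives. The `+ 1` covers `A' =
  -- 0`.
  obtain ⟨C, hC⟩ := exists_rpow_le_mul_add (θ := r / p) (ε := γ / (2 * (A' + 1)))
    (by positivity) (by rwa [div_lt_one hp0]) (by positivity)
  refine ⟨γ / 2, by positivity, A' * C + B * (b - a), fun v hv => ?_⟩
  have hvp := (memLp_ofReal_iff_integrable_rpow hp0 hv.1).1 hv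
  set N := ∫ t, ‖v t‖ ^ p ∂(intervalMeasure a b) with hN
  have hN0 : 0 ≤ N := integral_nonneg fun t => by positivity
  have hu : ∀ t ∈ Icc a b, ‖leftRLIntegral a α v t‖ ^ r ≤ K ^ r * N ^ (r / p) := by
    intro t ht
    have e1 := hH d v hv a ⟨le_rfl, hab.le⟩ t ht
    rw [leftRLIntegral_left, sub_zero] at e1
    have e2 : ‖leftRLIntegral a α v t‖ ≤ K * N ^ (1 / p) :=
      e1.trans (mul_le_mul_of_nonneg_right ((le_abs_self _).trans (hK t ht)) (by positivity))
    refine (Real.rpow_le_rpow (norm_nonneg _) e2 hr).trans (le_of_eq ?_)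
    rw [Real.mul_rpow hK0 (by positivity), ← Real.rpow_mul hN0]
    congr 2
    ring
  have hlow : ∫ t, (γ * ‖v t‖ ^ p - (A * (K ^ r * N ^ (r / p)) + B)) ∂(intervalMeasure a b) ≤
      ∫ t, L (leftRLIntegral a α v t) (v t) t ∂(intervalMeasure a b) := by
    refine integral_mono_ae ((hvp.const_mul γ).sub (integrable_const _))
      (h1.integrable_comp hL hp0 (continuousOn_leftRLIntegral hp hpα hα hv) hv) ?_
    filter_upwards [ae_restrict_mem measurableSet_Ioo] with t ht
    have ht' := Ioo_subset_Icc_self ht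
    have e1 := h (leftRLIntegral a α v t) (v t) t ht'
    have e2 := mul_le_mul_of_nonneg_left (hu t ht') hA
    linarith
  rw [integral_sub (hvp.const_mul γ) (integrable_const _), integral_const_mul, integral_const,
    intervalMeasure_real_univ hab, smul_eq_mul, ← hN] at hlow
  have e1 : A' * N ^ (r / p) ≤ A' * (γ / (2 * (A' + 1)) * N + C) :=
    mul_le_mul_of_nonneg_left (hC N hN0) hA'
  have e2 : A' * (γ / (2 * (A' + 1)) * N) ≤ γ / 2 * N := by
    have : A' * (γ / (2 * (A' + 1))) ≤ γ / 2 := by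
      rw [← mul_div_assoc, div_le_div_iff₀ (by positivity) two_pos]
      nlinarith
    nlinarith
  have e3 : (b - a) * (A * (K ^ r * N ^ (r / p)) + B) = A' * N ^ (r / p) + B * (b - a) := by
    simp only [A']
    ring
  linarith

/-- Convexity of the set of densities that almost minimize `w ↦ ∫ L(u, w, t)`, are bounded in
`L^p`, and whose fractional integrals are uniformly close to `u`. -/
lemma convex_setOf_almost_minimizers (hp : 0 < 1 / p) (hpα : 1 / p < α) (hα : α < 1)
    (hL : LagrangianC1 a b L) (h1 : HypH1 a b p L) (h5 : HypH5'' a b L) {u : ℝ → RR d}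
    (hu : ContinuousOn u (Icc a b)) (M ε c : ℝ) :
    Convex ℝ {w : ℝ → RR d | MemLp w (ENNReal.ofReal p) (intervalMeasure a b) ∧
      ∫ t, ‖w t‖ ^ p ∂(intervalMeasure a b) ≤ M ∧
      (∀ t ∈ Icc a b, ‖leftRLIntegral a α w t - u t‖ ≤ ε) ∧
      ∫ t, L (u t) (w t) t ∂(intervalMeasure a b) ≤ c} := by
  have h1p := one_lt_of_one_div_lt hp hpα hα
  have hp0 : 0 < p := by linarith
  rintro v ⟨hv, hvM, hvε, hvc⟩ w ⟨hw, hwM, hwε, hwc⟩ x y hx hy hxy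
  have hvw : MemLp (x • v + y • w) (ENNReal.ofReal p) (intervalMeasure a b) :=
    (hv.const_smul x).add (hw.const_smul y)
  have hcombo : ∀ r s m : ℝ, r ≤ m → s ≤ m → x * r + y * s ≤ m := by
    intro r s m hr hs
    have e1 := mul_le_mul_of_nonneg_left hr hx
    have e2 := mul_le_mul_of_nonneg_left hs hy
    calc x * r + y * s ≤ x * m + y * m := add_le_add e1 e2
      _ = m := by rw [← add_mul, hxy, one_mul]
  refine ⟨hvw, ?_, fun t ht => ?_, ?_⟩
  · have hvp := (memLp_ofReal_iff_integrable_rpow hp0 hv.1).1 hv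
    have hwp := (memLp_ofReal_iff_integrable_rpow hp0 hw.1).1 hw
    refine le_trans ?_ (hcombo _ _ _ hvM hwM)
    rw [← integral_const_mul, ← integral_const_mul,
      ← integral_add (hvp.const_mul x) (hwp.const_mul y)]
    refine integral_mono ((memLp_ofReal_iff_integrable_rpow hp0 hvw.1).1 hvw)
      ((hvp.const_mul x).add (hwp.const_mul y)) fun t => ?_
    have e1 : ‖(x • v + y • w) t‖ ≤ x * ‖v t‖ + y * ‖w t‖ := by
      refine (norm_add_le _ _).trans (le_of_eq ?_)
      simp [norm_smul, abs_of_nonneg hx, abs_of_nonneg hy]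
    exact (Real.rpow_le_rpow (norm_nonneg _) e1 hp0.le).trans
      ((convexOn_rpow h1p.le).2 (norm_nonneg (v t)) (norm_nonneg (w t)) hx hy hxy)
  · rw [leftRLIntegral_combo hp hpα hα ht hv hw]
    have e1 : x • leftRLIntegral a α v t + y • leftRLIntegral a α w t - u t =
        x • (leftRLIntegral a α v t - u t) + y • (leftRLIntegral a α w t - u t) := by
      obtain rfl : y = 1 - x := by linarith
      module
    rw [e1]
    refine (norm_add_le _ _).trans ?_
    rw [norm_smul, norm_smul, Real.norm_of_nonneg hx, Real.norm_of_nonneg hy]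
    exact hcombo _ _ _ (hvε t ht) (hwε t ht)
  · have hvL := h1.integrable_comp hL hp0 hu hv
    have hwL := h1.integrable_comp hL hp0 hu hw
    refine le_trans ?_ (hcombo _ _ _ hvc hwc)
    rw [← integral_const_mul, ← integral_const_mul,
      ← integral_add (hvL.const_mul x) (hwL.const_mul y)]
    refine integral_mono_ae (h1.integrable_comp hL hp0 hu hvw)
      ((hvL.const_mul x).add (hwL.const_mul y)) ?_
    filter_upwards [ae_restrict_mem measurableSet_Ioo] with t ht
    exact (h5 (u t) t (Ioo_subset_Icc_self ht)).2 (mem_univ (v t)) (mem_univ (w t)) hx hy hxy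

/-- Existence of a minimizing density `v`. -/
theorem exists_minimizing_density (hab : a < b) (hp : 0 < 1 / p) (hpα : 1 / p < α) (hα : α < 1)
    (hL : LagrangianC1 a b L) (h1 : HypH1 a b p L) (h2 : HypH2 a b p L) (h4 : HypH4 a b p L)
    (h5 : HypH5'' a b L) :
    ∃ v : ℝ → RR d, MemLp v (ENNReal.ofReal p) (intervalMeasure a b) ∧
      ∀ w : ℝ → RR d, MemLp w (ENNReal.ofReal p) (intervalMeasure a b) →
        ∫ t, L (leftRLIntegral a α v t) (v t) t ∂(intervalMeasure a b) ≤
          ∫ t, L (leftRLIntegral a α w t) (w t) t ∂(intervalMeasure a b) := by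
  have h1p := one_lt_of_one_div_lt hp hpα hα
  have hp0 : 0 < p := by linarith
  let μ := intervalMeasure a b
  let J : (ℝ → RR d) → ℝ := fun v => ∫ t, L (leftRLIntegral a α v t) (v t) t ∂μ
  let S : Set (ℝ → RR d) := {v | MemLp v (ENNReal.ofReal p) μ}
  have hrpow : ∀ v ∈ S, Integrable (fun t => ‖v t‖ ^ p) μ := fun v hv =>
    (memLp_ofReal_iff_integrable_rpow hp0 hv.1).1 hv
  obtain ⟨γ, hγ, C₀, hcoer⟩ := exists_coercive_bound hab hp hpα hα hL h1 h4
  have hSne : S.Nonempty := ⟨0, MemLp.zero⟩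
  have hbdd : BddBelow (J '' S) := by
    refine ⟨-C₀, ?_⟩
    rintro _ ⟨v, hv, rfl⟩
    have e1 := hcoer v hv
    have e2 : 0 ≤ ∫ t, ‖v t‖ ^ p ∂μ := integral_nonneg fun t => by positivity
    have e3 := mul_nonneg hγ.le e2
    change _ ≤ J v at e1
    linarith
  set m := sInf (J '' S) with hm
  have hmle : ∀ v ∈ S, m ≤ J v := fun v hv => csInf_le hbdd (mem_image_of_mem _ hv)
  suffices hmain : ∃ v ∈ S, J v ≤ m by
    obtain ⟨v, hv, hvm⟩ := hmain
    exact ⟨v, hv, fun w hw => hvm.trans (hmle w hw)⟩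
  -- a minimizing sequence and its bound in `L^p`
  have hex : ∀ n : ℕ, ∃ v ∈ S, J v < m + 1 / ((n : ℝ) + 1) := by
    intro n
    obtain ⟨_, ⟨v, hv, rfl⟩, h⟩ := exists_lt_of_csInf_lt (hSne.image J)
      (show sInf (J '' S) < m + 1 / ((n : ℝ) + 1) from lt_add_of_pos_right _ (by positivity))
    exact ⟨v, hv, h⟩
  choose V hVS hVJ using hex
  -- Coercivity together with `J (V n) < m + 1` gives this bound.
  let M : ℝ := (m + 1 + C₀) / γ
  have hVM : ∀ n, ∫ t, ‖V n t‖ ^ p ∂μ ≤ M := by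
    intro n
    have e1 := hcoer (V n) (hVS n)
    have e2 : 1 / ((n : ℝ) + 1) ≤ 1 := by
      rw [div_le_one (by positivity)]
      linarith [n.cast_nonneg (α := ℝ)]
    rw [le_div_iff₀ hγ]
    have e3 := hVJ n
    change _ ≤ J (V n) at e1
    linarith
  have hM0 : 0 ≤ M := (integral_nonneg fun t => by positivity).trans (hVM 0)
  -- uniform convergence of the fractional integrals
  obtain ⟨H, hHc, hH0, hHpos, hH⟩ := exists_modulus_leftRLIntegral (a := a) (b := b) hp hpα hα
  have hmod : ∀ n, ∀ s ∈ Icc a b, ∀ t ∈ Icc a b,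
      ‖leftRLIntegral a α (V n) t - leftRLIntegral a α (V n) s‖ ≤ H (t - s) * M ^ (1 / p) := by
    intro n s hs t ht
    refine (hH d (V n) (hVS n) s hs t ht).trans (mul_le_mul_of_nonneg_left ?_ (hHpos _))
    exact Real.rpow_le_rpow (integral_nonneg fun t => by positivity) (hVM n) hp.le
  obtain ⟨R, hR⟩ := isCompact_Icc.exists_bound_of_continuousOn
    (show ContinuousOn (fun t => H (t - a) * M ^ (1 / p)) (Icc a b) by fun_prop)
  have hVR : ∀ n, ∀ t ∈ Icc a b, ‖leftRLIntegral a α (V n) t‖ ≤ R := by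
    intro n t ht
    have e1 := hmod n a ⟨le_rfl, hab.le⟩ t ht
    rw [leftRLIntegral_left, sub_zero] at e1
    exact e1.trans ((le_abs_self _).trans (hR t ht))
  obtain ⟨φ, hφ, u, hu, hunif⟩ := exists_subseq_tendstoUniformlyOn_Icc
    (H := fun h => H h * M ^ (1 / p)) (by fun_prop) (by simp [hH0]) hmod hVR
  have huR : ∀ t ∈ Icc a b, ‖u t‖ ≤ R := by
    intro t ht
    refine le_of_forall_pos_le_add fun ε hε => ?_
    obtain ⟨N, hN⟩ := hunif ε hε
    have e1 := hN N le_rfl t ht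
    have e2 := hVR (φ N) t ht
    have e3 := norm_sub_norm_le (u t) (leftRLIntegral a α (V (φ N)) t)
    rw [norm_sub_rev] at e3
    linarith
  -- freezing the first variable of the Lagrangian
  obtain ⟨C, hC, hLip⟩ := h2.exists_lipschitz hL R
  let D : ℝ := C * (b - a + M)
  have hD : 0 ≤ D := mul_nonneg hC (by linarith)
  -- The Lipschitz constant in the first variable is `C (1 + ‖y‖ ^ p)`, whose integral along `V n`
  -- is at most `D`.
  have hfreeze : ∀ n, ∀ η : ℝ, (∀ t ∈ Icc a b, ‖leftRLIntegral a α (V n) t - u t‖ ≤ η) →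
      ∫ t, L (u t) (V n t) t ∂μ ≤ J (V n) + D * η := by
    intro n η hη
    have hη0 : 0 ≤ η := (norm_nonneg _).trans (hη a ⟨le_rfl, hab.le⟩)
    have hi1 := h1.integrable_comp hL hp0 hu (hVS n)
    have hi2 := h1.integrable_comp hL hp0 (continuousOn_leftRLIntegral hp hpα hα (hVS n)) (hVS n)
    have hi3 : Integrable (fun t => 1 + ‖V n t‖ ^ p) μ :=
      (integrable_const (1 : ℝ)).add (hrpow _ (hVS n))
    have e1 : ∫ t, L (u t) (V n t) t ∂μ ≤
        ∫ t, (L (leftRLIntegral a α (V n) t) (V n t) t + C * η * (1 + ‖V n t‖ ^ p)) ∂μ := by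
      refine integral_mono_ae hi1 (hi2.add (hi3.const_mul (C * η))) ?_
      filter_upwards [ae_restrict_mem measurableSet_Ioo] with t ht
      have ht' := Ioo_subset_Icc_self ht
      have f1 := (le_abs_self _).trans
        (hLip _ (hVR n t ht') _ (huR t ht') (V n t) t ht')
      have f2 := hη t ht'
      rw [norm_sub_rev] at f2
      have f3 : 0 ≤ C * (1 + ‖V n t‖ ^ p) := by positivity
      have f4 := mul_le_mul_of_nonneg_left f2 f3
      linarith
    rw [integral_add hi2 (hi3.const_mul _), integral_const_mul,
      integral_add (integrable_const _) (hrpow _ (hVS n)), integral_const,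
      intervalMeasure_real_univ hab, smul_eq_mul, mul_one] at e1
    have e2 : C * η * (b - a + ∫ t, ‖V n t‖ ^ p ∂μ) ≤ C * η * (b - a + M) :=
      mul_le_mul_of_nonneg_left (by linarith [hVM n]) (by positivity)
    have e3 : C * η * (b - a + M) = D * η := by simp only [D]; ring
    linarith
  -- almost everywhere convergent almost minimizers
  let K : ℕ → Set (ℝ → RR d) := fun k => {w | MemLp w (ENNReal.ofReal p) μ ∧
    ∫ t, ‖w t‖ ^ p ∂μ ≤ M ∧
    (∀ t ∈ Icc a b, ‖leftRLIntegral a α w t - u t‖ ≤ 1 / ((k : ℝ) + 1)) ∧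
    ∫ t, L (u t) (w t) t ∂μ ≤ m + 1 / ((k : ℝ) + 1)}
  have hKanti : Antitone K := by
    rintro i j hij w ⟨hw, hwM, hwu, hwL⟩
    have : 1 / ((j : ℝ) + 1) ≤ 1 / ((i : ℝ) + 1) := by
      have : (i : ℝ) ≤ j := by exact_mod_cast hij
      gcongr
    exact ⟨hw, hwM, fun t ht => (hwu t ht).trans this, hwL.trans (by linarith)⟩
  have hKne : ∀ k, (K k).Nonempty := by
    intro k
    have hk : (0 : ℝ) < 1 / ((k : ℝ) + 1) := by positivity
    set ε := 1 / ((k : ℝ) + 1)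
    -- Half of `ε` pays for freezing, as `D` times this tolerance is at most `ε / 2`. The other half
    -- pays for the minimization error of `V (φ n)`.
    obtain ⟨N, hN⟩ := hunif (ε / (2 * (D + 1))) (by positivity)
    obtain ⟨N', hN'⟩ := eventually_atTop.1
      ((tendsto_one_div_add_atTop_nhds_zero_nat (𝕜 := ℝ)).eventually (gt_mem_nhds (half_pos hk)))
    set n := max N N'
    have e0 := hN n (le_max_left _ _)
    have e1 := hN' (φ n) ((le_max_right _ _).trans (hφ.id_le n))
    have e2 : D * (ε / (2 * (D + 1))) ≤ ε / 2 := by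
      rw [← mul_div_assoc, div_le_div_iff₀ (by positivity) two_pos]
      nlinarith
    have e3 : ε / (2 * (D + 1)) ≤ ε := div_le_self hk.le (by linarith)
    refine ⟨V (φ n), hVS _, hVM _, fun t ht => (e0 t ht).trans e3, ?_⟩
    linarith [hfreeze _ _ e0, hVJ (φ n)]
  have hKint : ∀ w ∈ K 0, Integrable w μ := fun w hw =>
    hw.1.integrable (by rw [← ENNReal.ofReal_one]; exact ENNReal.ofReal_le_ofReal h1p.le)
  have hKnorm : ∀ w ∈ K 0, ∫ t, ‖w t‖ ∂μ ≤ b - a + M := by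
    intro w hw
    calc ∫ t, ‖w t‖ ∂μ ≤ ∫ t, (1 + ‖w t‖ ^ p) ∂μ := by
          refine integral_mono (hKint w hw).norm ((integrable_const (1 : ℝ)).add (hrpow w hw.1))
            fun t => ?_
          simpa using rpow_le_one_add_rpow (norm_nonneg (w t)) zero_le_one h1p.le
      _ = b - a + ∫ t, ‖w t‖ ^ p ∂μ := by
          rw [integral_add (integrable_const _) (hrpow w hw.1), integral_const,
            intervalMeasure_real_univ hab, smul_eq_mul, mul_one]
      _ ≤ b - a + M := by linarith [hw.2.1]
  obtain ⟨w, v, hwK, hwv⟩ := exists_tendsto_ae_of_antitone_convex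
    (fun k => convex_setOf_almost_minimizers hp hpα hα hL h1 h5 hu M _ _) hKanti hKne hKint hKnorm
  -- the limit
  have hvm : AEStronglyMeasurable v μ :=
    aestronglyMeasurable_of_tendsto_ae atTop (fun k => (hwK k).1.1) hwv
  have hvFatou : Integrable (fun t => ‖v t‖ ^ p) μ ∧ ∫ t, ‖v t‖ ^ p ∂μ ≤ M := by
    refine integrable_and_integral_le_of_tendsto_ae (f := fun k t => ‖w k t‖ ^ p)
      (fun k => hrpow _ (hwK k).1) (integrable_zero _ _ _)
      (fun k => Eventually.of_forall fun t => by
        change 0 ≤ ‖w k t‖ ^ p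
        positivity) ?_ (fun k => (hwK k).2.1) tendsto_const_nhds
    filter_upwards [hwv] with t ht
    exact ht.norm.rpow_const (Or.inr hp0.le)
  have hv : MemLp v (ENNReal.ofReal p) μ :=
    (memLp_ofReal_iff_integrable_rpow hp0 hvm).2 hvFatou.1
  -- Both `I^α v` and `u` are pointwise limits of `I^α (w k)`: the first by pairing with the kernel
  -- in `L^q`, the second because `w k ∈ K k`.
  have huv : ∀ t ∈ Icc a b, leftRLIntegral a α v t = u t := by
    intro t ht
    refine tendsto_nhds_unique (tendsto_leftRLIntegral_of_tendsto_ae hp hpα hα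
      (fun k => (hwK k).1) hv (fun k => (hwK k).2.1) hvFatou.2 hwv ht) ?_
    rw [tendsto_iff_norm_sub_tendsto_zero]
    exact squeeze_zero (fun _ => norm_nonneg _) (fun k => (hwK k).2.2.1 t ht)
      tendsto_one_div_add_atTop_nhds_zero_nat
  obtain ⟨γ', r, A, B, hγ', hr, -, hA, hlow⟩ := h4.exists_lower_bound
  -- The frozen `u` is bounded by `R`, so (H4) supplies a constant minorant independent of `k`, as
  -- Fatou's lemma requires.
  have hLFatou : ∫ t, L (u t) (v t) t ∂μ ≤ m := by
    refine (integrable_and_integral_le_of_tendsto_ae (f := fun k t => L (u t) (w k t) t)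
      (G := fun _ => -(A * R ^ r) - B) (c := fun k : ℕ => m + 1 / ((k : ℝ) + 1))
      (fun k => h1.integrable_comp hL hp0 hu (hwK k).1) (integrable_const _) (fun k => ?_) ?_
      (fun k => (hwK k).2.2.2) ?_).2
    · filter_upwards [ae_restrict_mem measurableSet_Ioo] with t ht
      have ht' := Ioo_subset_Icc_self ht
      have e1 := hlow (u t) (w k t) t ht'
      have e2 : 0 ≤ γ' * ‖w k t‖ ^ p := by positivity
      have e3 := mul_le_mul_of_nonneg_left
        (Real.rpow_le_rpow (norm_nonneg _) (huR t ht') hr) hA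
      linarith
    · filter_upwards [ae_restrict_mem measurableSet_Ioo, hwv] with t ht hwt
      exact ((hL.continuous_snd (u t) (Ioo_subset_Icc_self ht)).tendsto (v t)).comp hwt
    · simpa using (tendsto_const_nhds (x := m)).add
        (tendsto_one_div_add_atTop_nhds_zero_nat (𝕜 := ℝ))
  refine ⟨v, hv, le_trans (le_of_eq ?_) hLFatou⟩
  refine integral_congr_ae ?_
  filter_upwards [ae_restrict_mem measurableSet_Ioo] with t ht
  rw [huv t (Ioo_subset_Icc_self ht)]

end Minimization

/-! ### Transfer from densities back to `E_{α,p}` -/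

theorem theorem3 (d : ℕ) (hd : 0 < d) (a b : ℝ) (hab : a < b) (α p : ℝ)
    (hp : 0 < 1 / p) (hpα : 1 / p < α) (hα : α < 1)
    (L : RR d → RR d → ℝ → ℝ) (hL : LagrangianC1 a b L)
    (h1 : HypH1 a b p L) (h2 : HypH2 a b p L) (h3 : HypH3 a b p L) (h4 : HypH4 a b p L)
    (h5 : HypH5 a b L ∨ HypH5' a b L ∨ HypH5'' a b L) :
    (∀ v ∈ fracSpace d a b α p, IntegrableOn (lagrangianIntegrand α L v) (Set.Ioo a b)) ∧
      ∃ u ∈ fracSpace d a b α p, ∀ v ∈ fracSpace d a b α p,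
        lagrangianFunctional α L u ≤ lagrangianFunctional α L v := by
  have hp0 : 0 < p := one_pos.trans (one_lt_of_one_div_lt hp hpα hα)
  have h5'' : HypH5'' a b L := by
    rcases h5 with h | h | h
    · exact hypH5''_of_hypH5 h
    · exact h.1
    · exact h
  -- On `E_{α,p}` the first argument is a.e. `I^α` of the second, so the functional depends on the
  -- density alone.
  have hdens : ∀ v ∈ fracSpace d a b α p,
      (fun t => L (leftRLIntegral a α (leftRLDeriv a α v) t) (leftRLDeriv a α v t) t)
        =ᵐ[intervalMeasure a b] lagrangianIntegrand α L v := by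
    intro v hv
    filter_upwards [hv.2.2] with t ht
    rw [lagrangianIntegrand, ht]
  refine ⟨fun v hv => ?_, ?_⟩
  · exact (h1.integrable_comp hL hp0 (continuousOn_leftRLIntegral hp hpα hα hv.2.1)
      hv.2.1).congr (hdens v hv)
  · obtain ⟨w, hw, hmin⟩ := exists_minimizing_density hab hp hpα hα hL h1 h2 h4 h5''
    obtain ⟨u, hu, hDu, hIu⟩ := exists_mem_fracSpace hab hp hpα hα hw
    refine ⟨u, hu, fun v hv => ?_⟩
    have e1 : lagrangianFunctional α L u =
        ∫ t, L (leftRLIntegral a α w t) (w t) t ∂(intervalMeasure a b) := by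
      refine integral_congr_ae ?_
      filter_upwards [hDu, hIu] with t ht ht'
      rw [lagrangianIntegrand, ht, ht']
    rw [e1, lagrangianFunctional, ← integral_congr_ae (hdens v hv)]
    exact hmin _ hv.2.1
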